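/- Let $X$ be a locally compact Hausdorff space. A complex vector bundle $\mathcal V=[E,p,X]$ is a locally trivial family of nonzero finite-dimensional complex vector spaces $p^{-1}(x)$, $x\in X$ (the rank is locally constant but may vary over $X$); a metric $\beta$ on $\mathcal V$ is a continuous map from the total space of $\mathcal V\oplus\mathcal V$ to $\mathbb C$ that restricts to an inner product on each fibre. Let $\Gamma_0(\mathcal V)$ be the space of continuous sections $\xi$ of $\mathcal V$ for which $x\mapsto\beta(\xi(x),\xi(x))$ vanishes at infinity, with $(\xi f)(x)=\xi(x)f(x)$ for $f\in C_0(X)$ and $\langle\xi,\eta\rangle(x)=\beta(\xi(x),\eta(x))$. For a Hilbert $C_0(X)$-module $\mathcal E$ and a compact set $K\subseteq X$, let $\mathcal E_K=\mathcal E/\mathcal E C_0(X\setminus K)$, a Hilbert module over $C(K)\cong C_0(X)/C_0(X\setminus K)$. The module $\mathcal E$ is called $\sigma$-finitely generated if for every compact $K\subseteq X$ there is a finite subset of $\mathcal E_K$ whose $C(K)$-linear span is dense in $\mathcal E_K$; it is called $\sigma$-projective if for every compact $K\subseteq X$ the $C(K)$-module $\mathcal E_K$ is projective, i.e. an (algebraic)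 direct summand of a free $C(K)$-module; it is called full if the closed linear span of $\{\langle\xi,\eta\rangle:\xi,\eta\in\mathcal E\}$ is $C_0(X)$. Then: (1) For every complex vector bundle $\mathcal V$ over $X$ and every metric $\beta$ on $\mathcal V$, $\Gamma_0(\mathcal V)$ is a (complete) Hilbert $C_0(X)$-module that is $\sigma$-finitely generated and $\sigma$-projective. (2) Conversely, for every full, $\sigma$-finitely generated and $\sigma$-projective Hilbert $C_0(X)$-module $\mathcal E$ there are a complex vector bundle $\mathcal V$ over $X$, a metric $\beta$ on $\mathcal V$ and a linear bijection $T:\mathcal E\to\Gamma_0(\mathcal V)$ with $T(\xi f)=T(\xi)f$ and $\langle T\xi,T\eta\rangle=\langle\xi,\eta\rangle$ for all $\xi,\eta\in\mathcal E$, $f\in C_0(X)$. -/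

import Mathlib

open Filter Topology Bundle
open scoped ZeroAtInfty ComplexOrder

universe u v w

noncomputable section

/-! ### The C⋆-algebra `C₀(X)` with its pointwise order -/

section Order

variable {X : Type u} [TopologicalSpace X]

/-- The pointwise order on `C₀(X, ℂ)`. -/
instance C0.instPartialOrder : PartialOrder C₀(X, ℂ) :=
  PartialOrder.lift (fun f => (f : X → ℂ)) DFunLike.coe_injective

theorem C0.le_def {f g : C₀(X, ℂ)} : f ≤ g ↔ ∀ x, f x ≤ g x := Iff.rfl

/-- The pointwise order is the usual order of the C⋆-algebra `C₀(X, ℂ)`. -/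
instance C0.instStarOrderedRing : StarOrderedRing C₀(X, ℂ) := by
  refine StarOrderedRing.of_le_iff fun f g => ⟨fun h => ?_, ?_⟩
  · refine ⟨⟨⟨fun x => ((Real.sqrt ((g x - f x).re) : ℝ) : ℂ), ?_⟩, ?_⟩, ?_⟩
    · have := g.continuous.sub f.continuous
      exact Complex.continuous_ofReal.comp
        (Real.continuous_sqrt.comp (Complex.continuous_re.comp this))
    · have h0 : Tendsto (fun x => g x - f x) (cocompact X) (𝓝 0) := by
        simpa using (zero_at_infty g).sub (zero_at_infty f)
      have h1 : Continuous fun z : ℂ => ((Real.sqrt z.re : ℝ) : ℂ) := by fun_prop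
      have h2 := (h1.tendsto 0).comp h0
      simp only [Complex.zero_re, Real.sqrt_zero, Complex.ofReal_zero] at h2
      exact h2
    · ext x
      have hx : f x ≤ g x := h x
      have h1 : 0 ≤ (g x - f x).re := by
        simpa using (Complex.le_def.1 hx).1
      have h2 : (g x - f x).im = 0 := by
        simp [(Complex.le_def.1 hx).2]
      have h3 : ((Real.sqrt ((g x - f x).re) : ℝ) : ℂ) * (Real.sqrt ((g x - f x).re) : ℝ)
          = g x - f x := by
        rw [← Complex.ofReal_mul, Real.mul_self_sqrt h1]
        exact Complex.ext (by simp) (by simp [h2])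
      simp only [ZeroAtInftyContinuousMap.add_apply, ZeroAtInftyContinuousMap.mul_apply,
        ZeroAtInftyContinuousMap.star_apply, ZeroAtInftyContinuousMap.coe_mk]
      have h4 : star ((Real.sqrt ((g x - f x).re) : ℝ) : ℂ) = (Real.sqrt ((g x - f x).re) : ℝ) :=
        Complex.conj_ofReal _
      erw [h4, h3]
      ring
  · rintro ⟨s, rfl⟩ x
    simp only [ZeroAtInftyContinuousMap.add_apply, ZeroAtInftyContinuousMap.mul_apply,
        ZeroAtInftyContinuousMap.star_apply]
    exact le_add_of_nonneg_right (star_mul_self_nonneg _)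

end Order

/-! ### Hilbert `C₀(X)`-modules

A Hilbert `C₀(X)`-module is a complete `CStarModule C₀(X, ℂ) E`. As `C₀(X)` is commutative,
the right action `ξ f` is written `f • ξ`; the usual laws of the action follow from those of the
inner product. -/

namespace HilbertC0

section Action

variable {X : Type u} [TopologicalSpace X] {E : Type v} [NormedAddCommGroup E] [NormedSpace ℂ E]
  [SMul C₀(X, ℂ) E] [CStarModule C₀(X, ℂ) E]

variable (X) in
theorem ext_inner {x y : E} (h : ∀ z : E, inner C₀(X, ℂ) z x = inner C₀(X, ℂ) z y) : x = y := by
  rw [← sub_eq_zero, ← CStarModule.inner_self (A := C₀(X, ℂ)), CStarModule.inner_sub_right, h,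
    sub_self]

theorem smul_add' (f : C₀(X, ℂ)) (x y : E) : f • (x + y) = f • x + f • y :=
  ext_inner X fun z => by simp [mul_add]

theorem add_smul' (f g : C₀(X, ℂ)) (x : E) : (f + g) • x = f • x + g • x :=
  ext_inner X fun z => by simp [add_mul]

theorem sub_smul' (f g : C₀(X, ℂ)) (x : E) : (f - g) • x = f • x - g • x :=
  ext_inner X fun z => by simp [sub_mul]

theorem mul_smul' (f g : C₀(X, ℂ)) (x : E) : (f * g) • x = f • g • x :=
  ext_inner X fun z => by simp [mul_assoc]

theorem smul_comm' (f : C₀(X, ℂ)) (c : ℂ) (x : E) : f • c • x = c • f • x :=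
  ext_inner X fun z => by simp [mul_smul_comm]

theorem norm_smul_le' (f : C₀(X, ℂ)) (x : E) : ‖f • x‖ ≤ ‖f‖ * ‖x‖ := by
  have h : ‖f • x‖ ^ 2 ≤ (‖f‖ * ‖x‖) ^ 2 := by
    rw [mul_pow, CStarModule.norm_sq_eq C₀(X, ℂ), CStarModule.norm_sq_eq C₀(X, ℂ) (x := x),
      CStarModule.inner_op_smul_right, CStarModule.inner_op_smul_left]
    calc _ ≤ ‖f‖ * (‖inner C₀(X, ℂ) x x‖ * ‖star f‖) :=
          (norm_mul_le _ _).trans (by gcongr; exact norm_mul_le _ _)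
      _ = _ := by rw [norm_star (E := C₀(X, ℂ))]; ring
  exact le_of_sq_le_sq h (by positivity)

/-- The action of `f ∈ C₀(X)` on `E`, as a continuous linear map. -/
def smulCLM (f : C₀(X, ℂ)) : E →L[ℂ] E :=
  LinearMap.mkContinuous
    { toFun := fun x => f • x
      map_add' := smul_add' f
      map_smul' := fun c x => smul_comm' f c x } ‖f‖ (norm_smul_le' f)

@[simp] theorem smulCLM_apply (f : C₀(X, ℂ)) (x : E) : smulCLM f x = f • x := rfl

theorem norm_le_of_forall {f : C₀(X, ℂ)} {c : ℝ} (hc : 0 ≤ c) (h : ∀ x, ‖f x‖ ≤ c) : ‖f‖ ≤ c := by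
  rw [← ZeroAtInftyContinuousMap.norm_toBCF_eq_norm]
  exact (BoundedContinuousFunction.norm_le hc).2 h

theorem norm_apply_le (f : C₀(X, ℂ)) (x : X) : ‖f x‖ ≤ ‖f‖ := by
  rw [← ZeroAtInftyContinuousMap.norm_toBCF_eq_norm]
  exact f.toBCF.norm_coe_le_norm x

variable (X) in
/-- Every element is approximated by its multiples with functions in `C₀(X)`. -/
theorem exists_norm_sub_smul_lt (ξ : E) {ε : ℝ} (hε : 0 < ε) :
    ∃ b : C₀(X, ℂ), ‖ξ - b • ξ‖ < ε := by
  set h : C₀(X, ℂ) := inner C₀(X, ℂ) ξ ξ with hh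
  obtain ⟨δ, hδ, hδε⟩ : ∃ δ : ℝ, 0 < δ ∧ δ < ε ^ 2 := exists_between (by positivity)
  have hpos : ∀ z : ℂ, δ + ‖z‖ ≠ 0 := fun z => by positivity
  have hcont : Continuous fun z : ℂ => ((‖z‖ / (δ + ‖z‖) : ℝ) : ℂ) :=
    Complex.continuous_ofReal.comp (continuous_norm.div (by fun_prop) hpos)
  let b : C₀(X, ℂ) := ⟨⟨fun x => ((‖h x‖ / (δ + ‖h x‖) : ℝ) : ℂ), hcont.comp h.continuous⟩, by
    have := (hcont.tendsto 0).comp (zero_at_infty h)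
    simp only [norm_zero, zero_div, Complex.ofReal_zero] at this
    exact this⟩
  have hb : ∀ x, b x = ((‖h x‖ / (δ + ‖h x‖) : ℝ) : ℂ) := fun x => rfl
  refine ⟨b, ?_⟩
  have h1 : ‖ξ - b • ξ‖ ^ 2 ≤ δ := by
    rw [CStarModule.norm_sq_eq C₀(X, ℂ)]
    refine norm_le_of_forall hδ.le fun x => ?_
    have h2 : (inner C₀(X, ℂ) (ξ - b • ξ) (ξ - b • ξ) : C₀(X, ℂ)) x
        = h x * ((δ / (δ + ‖h x‖) : ℝ) : ℂ) ^ 2 := by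
      have h3 : star (b x) = b x := by rw [hb]; exact Complex.conj_ofReal _
      have h4 : ((δ / (δ + ‖h x‖) : ℝ) : ℂ) = 1 - b x := by
        rw [hb, ← Complex.ofReal_one, ← Complex.ofReal_sub]
        congr 1
        have := hpos (h x)
        field_simp
        ring
      simp only [CStarModule.inner_sub_left, CStarModule.inner_sub_right,
        CStarModule.inner_op_smul_left, CStarModule.inner_op_smul_right, ← hh,
        ZeroAtInftyContinuousMap.sub_apply, ZeroAtInftyContinuousMap.mul_apply,
        ZeroAtInftyContinuousMap.star_apply, h3, h4]
      ring
    rw [h2, norm_mul, norm_pow, Complex.norm_real, Real.norm_of_nonneg (by positivity), div_pow,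
      mul_div_assoc', div_le_iff₀ (by positivity)]
    nlinarith [norm_nonneg (h x), hδ, mul_nonneg hδ.le (norm_nonneg (h x)), sq_nonneg ‖h x‖,
      mul_nonneg hδ.le (sq_nonneg ‖h x‖), mul_nonneg (sq_nonneg δ) (norm_nonneg (h x)),
      pow_pos hδ 3]
  exact lt_of_pow_lt_pow_left₀ 2 hε.le (h1.trans_lt hδε)

end Action

/-- `E` is full: the closed linear span of the inner products is all of `C₀(X)`. -/
def IsFull (X : Type u) [TopologicalSpace X] (E : Type v) [NormedAddCommGroup E]
    [NormedSpace ℂ E] [SMul C₀(X, ℂ) E] [CStarModule C₀(X, ℂ) E] : Prop :=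
  closure (Submodule.span ℂ
    (Set.range fun p : E × E => inner C₀(X, ℂ) p.1 p.2) : Set C₀(X, ℂ)) = Set.univ

/-! ### The restriction `E_K = E / E C₀(X \ K)` to a compact set `K`, as a `C(K)`-module -/

section Restriction

variable {X : Type u} [TopologicalSpace X]

/-- The submodule `E C₀(X \ K)`, the closed linear span of all `f • ξ` with `f ∈ C₀(X)` vanishing
on `K`. (If `E` is complete, every element of it is itself of the form `f • ξ`, by Cohen
factorization.) -/
def idealSubmodule (E : Type v) [NormedAddCommGroup E] [NormedSpace ℂ E]
    [SMul C₀(X, ℂ) E] [CStarModule C₀(X, ℂ) E] (K : TopologicalSpace.Compacts X) :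
    Submodule ℂ E :=
  (Submodule.span ℂ
    {ζ : E | ∃ (f : C₀(X, ℂ)) (ξ : E), (∀ x ∈ K, f x = 0) ∧ ζ = f • ξ}).topologicalClosure

/-- The quotient `E_K = E / E C₀(X \ K)`. -/
def Restriction (E : Type v) [NormedAddCommGroup E] [NormedSpace ℂ E]
    [SMul C₀(X, ℂ) E] [CStarModule C₀(X, ℂ) E] (K : TopologicalSpace.Compacts X) : Type v :=
  E ⧸ idealSubmodule E K

/-- Every continuous function on a compact set extends to a function in `C₀(X)`. -/
theorem exists_extension [LocallyCompactSpace X] [T2Space X] (K : TopologicalSpace.Compacts X)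
    (g : C(K, ℂ)) : ∃ f : C₀(X, ℂ), ∀ x : K, f x = g x := by
  have : CompactSpace K := isCompact_iff_compactSpace.1 K.isCompact
  have hemb : IsClosedEmbedding (fun x : K => ((x : X) : OnePoint X)) :=
    (OnePoint.continuous_coe.comp continuous_subtype_val).isClosedEmbedding
      (OnePoint.coe_injective.comp Subtype.val_injective)
  obtain ⟨G, hG⟩ := g.exists_extension' hemb
  obtain ⟨k, hk1, -, hk, -⟩ := exists_continuous_one_zero_of_isCompact K.isCompact
    isClosed_empty (Set.disjoint_empty _)
  refine ⟨⟨⟨fun x => (k x : ℂ) * G (x : OnePoint X), ?_⟩, ?_⟩, fun x => ?_⟩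
  · exact (Complex.continuous_ofReal.comp k.continuous).mul
      (G.continuous.comp OnePoint.continuous_coe)
  · refine HasCompactSupport.is_zero_at_infty ?_
    exact (hk.comp_left (g := fun t : ℝ => (t : ℂ)) Complex.ofReal_zero).mul_right
  · have h1 : k x = 1 := hk1 x.2
    have h2 : G ((x : X) : OnePoint X) = g x := congrFun hG x
    change (k x : ℂ) * G ((x : X) : OnePoint X) = g x
    rw [h1, h2]; simp

/-- A function in `C₀(X)` extending `g ∈ C(K)`. -/
def extend [LocallyCompactSpace X] [T2Space X] {K : TopologicalSpace.Compacts X}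
    (g : C(K, ℂ)) : C₀(X, ℂ) := (exists_extension K g).choose

theorem extend_apply [LocallyCompactSpace X] [T2Space X] {K : TopologicalSpace.Compacts X}
    (g : C(K, ℂ)) {x : X} (hx : x ∈ K) : extend g x = g ⟨x, hx⟩ :=
  (exists_extension K g).choose_spec ⟨x, hx⟩

variable {E : Type v} [NormedAddCommGroup E] [NormedSpace ℂ E]
  [SMul C₀(X, ℂ) E] [CStarModule C₀(X, ℂ) E] {K : TopologicalSpace.Compacts X}

theorem smul_mem_idealSubmodule {f : C₀(X, ℂ)} (hf : ∀ x ∈ K, f x = 0) (ξ : E) :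
    f • ξ ∈ idealSubmodule E K :=
  Submodule.le_topologicalClosure _ (Submodule.subset_span ⟨f, ξ, hf, rfl⟩)

theorem idealSubmodule_le_comap (f : C₀(X, ℂ)) :
    idealSubmodule E K ≤ (idealSubmodule E K).comap (smulCLM (E := E) f).toLinearMap := by
  refine Submodule.topologicalClosure_minimal _ (Submodule.span_le.2 ?_) ?_
  · rintro _ ⟨g, ξ, hg, rfl⟩
    change f • g • ξ ∈ idealSubmodule E K
    rw [← mul_smul']
    exact smul_mem_idealSubmodule (fun x hx => by simp [hg x hx]) ξ
  · exact (Submodule.isClosed_topologicalClosure _).preimage (smulCLM (E := E) f).continuous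

/-- Elements of `C₀(X)` equal to one on `K` act trivially modulo `E C₀(X \ K)`. -/
theorem sub_smul_mem_idealSubmodule {f : C₀(X, ℂ)} (hf : ∀ x ∈ K, f x = 1) (ξ : E) :
    ξ - f • ξ ∈ idealSubmodule E K := by
  have hcl : IsClosed (idealSubmodule E K : Set E) := Submodule.isClosed_topologicalClosure _
  rw [← SetLike.mem_coe, ← hcl.closure_eq, Metric.mem_closure_iff]
  intro ε hε
  obtain ⟨b, hb⟩ := exists_norm_sub_smul_lt X ξ (ε := ε / (1 + ‖f‖)) (by positivity)
  refine ⟨(b - f * b) • ξ, smul_mem_idealSubmodule (fun x hx => by simp [hf x hx]) ξ, ?_⟩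
  have h1 : ξ - f • ξ - (b - f * b) • ξ = (ξ - b • ξ) - f • (ξ - b • ξ) := by
    have := (smulCLM (E := E) f).map_sub ξ (b • ξ)
    simp only [smulCLM_apply] at this
    rw [this, sub_smul', mul_smul']
    abel
  rw [dist_eq_norm, h1]
  calc _ ≤ ‖ξ - b • ξ‖ + ‖f‖ * ‖ξ - b • ξ‖ :=
        (norm_sub_le _ _).trans (by gcongr; exact norm_smul_le' _ _)
    _ = (1 + ‖f‖) * ‖ξ - b • ξ‖ := by ring
    _ < (1 + ‖f‖) * (ε / (1 + ‖f‖)) := by gcongr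
    _ = ε := by field_simp

/-- The quotient norm on `E_K`. It is equal to the norm given by the inner product
`⟨[ξ], [η]⟩ = ⟨ξ, η⟩|_K`, see `norm_mk`. -/
instance : NormedAddCommGroup (Restriction E K) :=
  haveI : IsClosed (idealSubmodule E K : Set E) := Submodule.isClosed_topologicalClosure _
  inferInstanceAs (NormedAddCommGroup (E ⧸ idealSubmodule E K))

instance : NormedSpace ℂ (Restriction E K) :=
  inferInstanceAs (NormedSpace ℂ (E ⧸ idealSubmodule E K))

/-- The quotient map `E → E_K`. -/
def Restriction.mk (K : TopologicalSpace.Compacts X) : E →ₗ[ℂ] Restriction E K :=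
  (idealSubmodule E K).mkQ

theorem Restriction.mk_surjective : Function.Surjective (Restriction.mk (E := E) K) :=
  Submodule.mkQ_surjective _

theorem Restriction.mk_eq_mk {ξ η : E} :
    Restriction.mk K ξ = Restriction.mk K η ↔ ξ - η ∈ idealSubmodule E K :=
  Submodule.Quotient.eq _

/-! The inner product `⟨[ξ], [η]⟩ = ⟨ξ, η⟩|_K` on `E_K`. -/

/-- The restriction map `C₀(X) → C(K)`. -/
def restrict (K : TopologicalSpace.Compacts X) (f : C₀(X, ℂ)) : C(K, ℂ) :=
  ⟨fun x => f x, f.continuous.comp continuous_subtype_val⟩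

theorem inner_apply_eq_zero {ζ : E} (hζ : ζ ∈ idealSubmodule E K) (ξ : E) {x : X} (hx : x ∈ K) :
    (inner C₀(X, ℂ) ξ ζ : C₀(X, ℂ)) x = 0 := by
  have hev : Continuous fun f : C₀(X, ℂ) => f x := by
    refine LipschitzWith.continuous (K := 1) (LipschitzWith.of_dist_le_mul fun f g => ?_)
    rw [dist_eq_norm, dist_eq_norm, NNReal.coe_one, one_mul]
    exact norm_apply_le (f - g) x
  let φ : E →ₗ[ℂ] ℂ :=
    { toFun := fun ζ => (inner C₀(X, ℂ) ξ ζ : C₀(X, ℂ)) x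
      map_add' := fun a b => by simp
      map_smul' := fun a b => by simp }
  have hφ : Continuous φ :=
    hev.comp (CStarModule.innerSL (A := C₀(X, ℂ)) ξ).continuous
  have hle : idealSubmodule E K ≤ LinearMap.ker φ := by
    refine Submodule.topologicalClosure_minimal _ (Submodule.span_le.2 ?_) ?_
    · rintro _ ⟨g, η, hg, rfl⟩
      simp [φ, hg x hx]
    · exact isClosed_singleton.preimage hφ
  exact hle hζ

theorem restrict_inner_congr {ξ ξ' η η' : E} (h : Restriction.mk K ξ = Restriction.mk K ξ')
    (h' : Restriction.mk K η = Restriction.mk K η') :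
    restrict K (inner C₀(X, ℂ) ξ η) = restrict K (inner C₀(X, ℂ) ξ' η') := by
  rw [Restriction.mk_eq_mk] at h h'
  ext x
  have h1 := inner_apply_eq_zero h' ξ x.2
  have h2 := inner_apply_eq_zero h η' x.2
  rw [CStarModule.inner_sub_right, ZeroAtInftyContinuousMap.sub_apply, sub_eq_zero] at h1 h2
  change (inner C₀(X, ℂ) ξ η : C₀(X, ℂ)) x = (inner C₀(X, ℂ) ξ' η' : C₀(X, ℂ)) x
  rw [h1, ← CStarModule.star_inner η' ξ, ← CStarModule.star_inner η' ξ',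
    ZeroAtInftyContinuousMap.star_apply, ZeroAtInftyContinuousMap.star_apply, h2]

instance : Inner C(K, ℂ) (Restriction E K) where
  inner p q := restrict K (inner C₀(X, ℂ) (Function.surjInv Restriction.mk_surjective p : E)
    (Function.surjInv Restriction.mk_surjective q))

theorem Restriction.inner_mk (ξ η : E) :
    inner C(K, ℂ) (Restriction.mk K ξ) (Restriction.mk K η)
      = restrict K (inner C₀(X, ℂ) ξ η) :=
  restrict_inner_congr (Function.surjInv_eq _ _) (Function.surjInv_eq _ _)

variable [LocallyCompactSpace X] [T2Space X]

/-- `g ∈ C(K)` acts on `E_K` by `g • [ξ] = [f • ξ]`, where `f ∈ C₀(X)` extends `g`. -/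
instance : SMul C(K, ℂ) (Restriction E K) where
  smul g := (idealSubmodule E K).mapQ (idealSubmodule E K)
    (smulCLM (E := E) (extend g)).toLinearMap (idealSubmodule_le_comap _)

/-- The action does not depend on the choice of the extension. -/
theorem Restriction.smul_mk {g : C(K, ℂ)} {f : C₀(X, ℂ)} (hf : ∀ x : K, f x = g x) (ξ : E) :
    g • Restriction.mk K ξ = Restriction.mk K (f • ξ) := by
  change Restriction.mk K (extend g • ξ) = _
  rw [Restriction.mk_eq_mk, ← sub_smul']
  refine smul_mem_idealSubmodule (fun x hx => ?_) ξ
  simp [extend_apply g hx, hf ⟨x, hx⟩]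

instance : Module C(K, ℂ) (Restriction E K) where
  one_smul q := by
    obtain ⟨ξ, rfl⟩ := Restriction.mk_surjective q
    rw [Restriction.smul_mk (f := extend 1) (fun x => extend_apply 1 x.2), eq_comm,
      Restriction.mk_eq_mk]
    exact sub_smul_mem_idealSubmodule (fun x hx => by simp [extend_apply 1 hx]) ξ
  mul_smul g h q := by
    obtain ⟨ξ, rfl⟩ := Restriction.mk_surjective q
    rw [Restriction.smul_mk (f := extend h) (fun x => extend_apply h x.2),
      Restriction.smul_mk (f := extend g) (fun x => extend_apply g x.2), ← mul_smul',
      Restriction.smul_mk (f := extend g * extend h)]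
    intro x
    simp [extend_apply _ x.2]
  smul_zero g := by
    rw [← map_zero (Restriction.mk (E := E) K),
      Restriction.smul_mk (f := extend g) (fun x => extend_apply g x.2)]
    congr 1
    exact (smulCLM (E := E) (extend g)).map_zero
  smul_add g p q := by
    obtain ⟨ξ, rfl⟩ := Restriction.mk_surjective p
    obtain ⟨η, rfl⟩ := Restriction.mk_surjective q
    have h : ∀ ζ : E, g • Restriction.mk K ζ = Restriction.mk K (extend g • ζ) :=
      Restriction.smul_mk fun x => extend_apply g x.2
    rw [← map_add, h, h, h, smul_add', map_add]
  add_smul g h q := by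
    obtain ⟨ξ, rfl⟩ := Restriction.mk_surjective q
    rw [Restriction.smul_mk (f := extend h) (fun x => extend_apply h x.2),
      Restriction.smul_mk (f := extend g) (fun x => extend_apply g x.2), ← map_add, ← add_smul',
      Restriction.smul_mk (f := extend g + extend h)]
    intro x
    simp [extend_apply _ x.2]
  zero_smul q := by
    obtain ⟨ξ, rfl⟩ := Restriction.mk_surjective q
    rw [Restriction.smul_mk (f := 0) (fun x => by simp)]
    have : (0 : C₀(X, ℂ)) • ξ = 0 := by simpa using sub_smul' (0 : C₀(X, ℂ)) 0 ξ
    rw [this, map_zero]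

theorem Restriction.norm_mk (ξ : E) :
    ‖Restriction.mk K ξ‖ = √‖restrict K (inner C₀(X, ℂ) ξ ξ)‖ := by
  have hnorm : ‖Restriction.mk K ξ‖ = Metric.infDist ξ (idealSubmodule E K : Set E) :=
    QuotientAddGroup.norm_mk (S := (idealSubmodule E K).toAddSubgroup) ξ
  refine le_antisymm ?_ (Real.sqrt_le_iff.2 ⟨norm_nonneg _, ?_⟩)
  · refine le_of_forall_pos_le_add fun ε hε => ?_
    set c := √‖restrict K (inner C₀(X, ℂ) ξ ξ)‖ with hc
    have hc0 : 0 ≤ c := Real.sqrt_nonneg _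
    set h : C₀(X, ℂ) := inner C₀(X, ℂ) ξ ξ with hh
    have hopen : IsOpen {x | ‖h x‖ < (c + ε) ^ 2} :=
      isOpen_lt (continuous_norm.comp h.continuous) continuous_const
    have hKU : (K : Set X) ⊆ {x | ‖h x‖ < (c + ε) ^ 2} := fun x hx => by
      have h1 : ‖h x‖ ≤ ‖restrict K h‖ := (restrict K h).norm_coe_le_norm ⟨x, hx⟩
      have h2 : c ^ 2 = ‖restrict K h‖ := Real.sq_sqrt (norm_nonneg _)
      change ‖h x‖ < (c + ε) ^ 2
      nlinarith
    obtain ⟨k, hk1, hk0, hk, hk01⟩ := exists_continuous_one_zero_of_isCompact K.isCompact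
      hopen.isClosed_compl (Set.disjoint_compl_right_iff_subset.2 hKU)
    let f : C₀(X, ℂ) := ⟨⟨fun x => (k x : ℂ), Complex.continuous_ofReal.comp k.continuous⟩,
      HasCompactSupport.is_zero_at_infty
        (hk.comp_left (g := fun t : ℝ => (t : ℂ)) Complex.ofReal_zero)⟩
    have hf : ∀ x, f x = (k x : ℂ) := fun x => rfl
    have h1 : Restriction.mk K ξ = Restriction.mk K (f • ξ) := by
      rw [Restriction.mk_eq_mk]
      refine sub_smul_mem_idealSubmodule (fun x hx => ?_) ξ
      have : k x = 1 := hk1 hx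
      rw [hf, this, Complex.ofReal_one]
    have h2 : ‖f • ξ‖ ^ 2 ≤ (c + ε) ^ 2 := by
      rw [CStarModule.norm_sq_eq C₀(X, ℂ)]
      refine norm_le_of_forall (by positivity) fun x => ?_
      rw [CStarModule.inner_op_smul_right, CStarModule.inner_op_smul_left, ← hh,
        ZeroAtInftyContinuousMap.mul_apply, ZeroAtInftyContinuousMap.mul_apply,
        ZeroAtInftyContinuousMap.star_apply, norm_mul, norm_mul, norm_star, hf,
        Complex.norm_real, Real.norm_of_nonneg (hk01 x).1]
      by_cases hx : x ∈ {x | ‖h x‖ < (c + ε) ^ 2}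
      · have hx' : ‖h x‖ < (c + ε) ^ 2 := hx
        have h3 := (hk01 x).1
        have h4 := (hk01 x).2
        calc k x * (‖h x‖ * k x) ≤ 1 * (‖h x‖ * 1) := by gcongr
          _ ≤ _ := by linarith
      · have : k x = 0 := hk0 hx
        rw [this, zero_mul]
        positivity
    rw [h1]
    calc ‖Restriction.mk K (f • ξ)‖ ≤ ‖f • ξ‖ :=
          Submodule.Quotient.norm_mk_le (idealSubmodule E K) (f • ξ)
      _ ≤ c + ε := le_of_sq_le_sq h2 (by positivity)
  · refine (ContinuousMap.norm_le _ (by positivity)).2 fun x => ?_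
    have h0 : 0 ≤ √‖(inner C₀(X, ℂ) ξ ξ : C₀(X, ℂ)) x‖ := Real.sqrt_nonneg _
    have key : √‖(inner C₀(X, ℂ) ξ ξ : C₀(X, ℂ)) x‖ ≤ ‖Restriction.mk K ξ‖ := by
      rw [hnorm]
      refine (Metric.le_infDist ⟨0, Submodule.zero_mem _⟩).2 fun ζ hζ => ?_
      have h1 : restrict K (inner C₀(X, ℂ) ξ ξ) = restrict K (inner C₀(X, ℂ) (ξ - ζ) (ξ - ζ)) := by
        have : Restriction.mk K ξ = Restriction.mk K (ξ - ζ) := by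
          rw [Restriction.mk_eq_mk]; simpa using hζ
        exact restrict_inner_congr this this
      have h2 : (inner C₀(X, ℂ) ξ ξ : C₀(X, ℂ)) x
          = (inner C₀(X, ℂ) (ξ - ζ) (ξ - ζ) : C₀(X, ℂ)) x := DFunLike.congr_fun h1 x
      rw [h2, dist_eq_norm, CStarModule.norm_eq_sqrt_norm_inner_self (A := C₀(X, ℂ)) (ξ - ζ)]
      exact Real.sqrt_le_sqrt (norm_apply_le _ _)
    calc ‖restrict K (inner C₀(X, ℂ) ξ ξ) x‖ = √‖(inner C₀(X, ℂ) ξ ξ : C₀(X, ℂ)) x‖ ^ 2 :=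
          (Real.sq_sqrt (norm_nonneg _)).symm
      _ ≤ _ := by gcongr

/-- The inner product `C(K)`-module `E_K`; it is complete if `E` is. -/
instance : CStarModule C(K, ℂ) (Restriction E K) where
  inner_add_right {p q r} := by
    obtain ⟨ξ, rfl⟩ := Restriction.mk_surjective p
    obtain ⟨η, rfl⟩ := Restriction.mk_surjective q
    obtain ⟨ζ, rfl⟩ := Restriction.mk_surjective r
    rw [← map_add, Restriction.inner_mk, Restriction.inner_mk, Restriction.inner_mk,
      CStarModule.inner_add_right]
    rfl
  inner_self_nonneg {p} := by
    obtain ⟨ξ, rfl⟩ := Restriction.mk_surjective p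
    rw [Restriction.inner_mk, ContinuousMap.le_def]
    intro x
    exact (CStarModule.inner_self_nonneg (A := C₀(X, ℂ)) (x := ξ) : _) x
  inner_self {p} := by
    obtain ⟨ξ, rfl⟩ := Restriction.mk_surjective p
    rw [Restriction.inner_mk, ← norm_eq_zero (a := Restriction.mk K ξ), Restriction.norm_mk,
      Real.sqrt_eq_zero (norm_nonneg _), norm_eq_zero]
  inner_op_smul_right {g p q} := by
    obtain ⟨ξ, rfl⟩ := Restriction.mk_surjective p
    obtain ⟨η, rfl⟩ := Restriction.mk_surjective q
    rw [Restriction.smul_mk (f := extend g) (fun x => extend_apply g x.2), Restriction.inner_mk,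
      Restriction.inner_mk, CStarModule.inner_op_smul_right]
    ext x
    simp [restrict, extend_apply g x.2]
  inner_smul_right_complex {z p q} := by
    obtain ⟨ξ, rfl⟩ := Restriction.mk_surjective p
    obtain ⟨η, rfl⟩ := Restriction.mk_surjective q
    rw [← map_smul, Restriction.inner_mk, Restriction.inner_mk,
      CStarModule.inner_smul_right_complex]
    rfl
  star_inner p q := by
    obtain ⟨ξ, rfl⟩ := Restriction.mk_surjective p
    obtain ⟨η, rfl⟩ := Restriction.mk_surjective q
    rw [Restriction.inner_mk, Restriction.inner_mk, ← CStarModule.star_inner ξ η]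
    rfl
  norm_eq_sqrt_norm_inner_self p := by
    obtain ⟨ξ, rfl⟩ := Restriction.mk_surjective p
    rw [Restriction.inner_mk, Restriction.norm_mk]

/-- `E` is `σ`-finitely generated: for every compact `K`, the `C(K)`-linear span of some finite
subset of `E_K` is dense in `E_K`. -/
def IsSigmaFinitelyGenerated (X : Type u) [TopologicalSpace X] [LocallyCompactSpace X] [T2Space X]
    (E : Type v) [NormedAddCommGroup E] [NormedSpace ℂ E] [SMul C₀(X, ℂ) E]
    [CStarModule C₀(X, ℂ) E] : Prop :=
  ∀ K : TopologicalSpace.Compacts X, ∃ S : Finset (Restriction E K),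
    Dense (Submodule.span C(K, ℂ) (S : Set (Restriction E K)) : Set (Restriction E K))

/-- `E` is `σ`-projective: for every compact `K`, the `C(K)`-module `E_K` is projective. -/
def IsSigmaProjective (X : Type u) [TopologicalSpace X] [LocallyCompactSpace X] [T2Space X]
    (E : Type v) [NormedAddCommGroup E] [NormedSpace ℂ E] [SMul C₀(X, ℂ) E]
    [CStarModule C₀(X, ℂ) E] : Prop :=
  ∀ K : TopologicalSpace.Compacts X, Module.Projective C(K, ℂ) (Restriction E K)

end Restriction

end HilbertC0
/-! ### Complex vector bundles with metric, and their sections vanishing at infinity -/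

/-- A complex vector bundle over `X`: a family of nonzero complex vector spaces with a topology on
the total space (the first argument `ℂ` of `TotalSpace` is a dummy) that is locally trivial with
finite-dimensional fibres; the rank may vary with the component. -/
structure ComplexVectorBundle (X : Type u) [TopologicalSpace X] where
  /-- The fibres. -/
  Fiber : X → Type w
  [addCommGroup : ∀ x, AddCommGroup (Fiber x)]
  [module : ∀ x, Module ℂ (Fiber x)]
  [topology : TopologicalSpace (TotalSpace ℂ Fiber)]
  nontrivial : ∀ x, Nontrivial (Fiber x)
  locally_trivial : ∀ x, ∃ (n : ℕ) (e : Trivialization (Fin n → ℂ) (π ℂ Fiber)),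
    x ∈ e.baseSet ∧ ∀ y ∈ e.baseSet, IsLinearMap ℂ fun v : Fiber y => (e ⟨y, v⟩).2

namespace ComplexVectorBundle

attribute [instance] addCommGroup module topology

variable {X : Type u} [TopologicalSpace X]

/-- A metric on a complex vector bundle: an inner product on each fibre (conjugate linear in the
first variable) that is continuous on the total space of the Whitney sum `V ⊕ V`. -/
structure Metric (V : ComplexVectorBundle.{u, w} X) where
  /-- The inner product on each fibre. -/
  core : ∀ x, InnerProductSpace.Core ℂ (V.Fiber x)
  continuous_inner : Continuous fun q : TotalSpace (ℂ × ℂ) (V.Fiber ×ᵇ V.Fiber) =>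
    (core q.proj).inner q.2.1 q.2.2

variable {V : ComplexVectorBundle.{u, w} X}

/-- The inner product `β(v, w)` of two vectors in the same fibre. -/
def Metric.form (β : V.Metric) {x : X} (v w : V.Fiber x) : ℂ := (β.core x).inner v w

/-- `s` is a continuous section. -/
def IsContinuousSection (s : ∀ x, V.Fiber x) : Prop :=
  Continuous fun x => (⟨x, s x⟩ : TotalSpace ℂ V.Fiber)

section Continuity

theorem continuousAt_section_iff {n : ℕ} (e : Trivialization (Fin n → ℂ) (π ℂ V.Fiber))
    (s : ∀ x, V.Fiber x) {x : X} (hx : x ∈ e.baseSet) :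
    ContinuousAt (fun y => (⟨y, s y⟩ : TotalSpace ℂ V.Fiber)) x ↔
      ContinuousAt (fun y => (e ⟨y, s y⟩).2) x := by
  have hsrc : ∀ y ∈ e.baseSet, (⟨y, s y⟩ : TotalSpace ℂ V.Fiber) ∈ e.source := fun y hy => by
    rw [e.source_eq]; exact hy
  have hnhds : (fun y => (⟨y, s y⟩ : TotalSpace ℂ V.Fiber)) ⁻¹' e.source ∈ 𝓝 x :=
    mem_of_superset (e.open_baseSet.mem_nhds hx) hsrc
  rw [e.toOpenPartialHomeomorph.continuousAt_iff_continuousAt_comp_left hnhds]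
  constructor
  · intro h
    exact continuousAt_snd.comp h
  · intro h
    refine (continuousAt_id.prodMk h).congr ?_
    filter_upwards [e.open_baseSet.mem_nhds hx] with y hy
    exact Prod.ext (e.proj_toFun _ (hsrc y hy)).symm rfl

theorem isContinuousSection_of_local {s : ∀ x, V.Fiber x}
    (h : ∀ (n : ℕ) (e : Trivialization (Fin n → ℂ) (π ℂ V.Fiber)),
      (∀ y ∈ e.baseSet, IsLinearMap ℂ fun v : V.Fiber y => (e ⟨y, v⟩).2) →
      ∀ x ∈ e.baseSet, ContinuousAt (fun y => (e ⟨y, s y⟩).2) x) : IsContinuousSection s := by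
  refine continuous_iff_continuousAt.2 fun x => ?_
  obtain ⟨n, e, hx, he⟩ := V.locally_trivial x
  exact (continuousAt_section_iff e s hx).2 (h n e he x hx)

theorem IsContinuousSection.add {s t : ∀ x, V.Fiber x} (hs : IsContinuousSection s)
    (ht : IsContinuousSection t) : IsContinuousSection (s + t) := by
  refine isContinuousSection_of_local fun n e he x hx => ?_
  have h1 := (continuousAt_section_iff e s hx).1 hs.continuousAt
  have h2 := (continuousAt_section_iff e t hx).1 ht.continuousAt
  refine (h1.add h2).congr ?_
  filter_upwards [e.open_baseSet.mem_nhds hx] with y hy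
  exact ((he y hy).map_add (s y) (t y)).symm

theorem IsContinuousSection.smul {s : ∀ x, V.Fiber x} (hs : IsContinuousSection s)
    {f : X → ℂ} (hf : Continuous f) : IsContinuousSection fun x => f x • s x := by
  refine isContinuousSection_of_local fun n e he x hx => ?_
  have h1 := (continuousAt_section_iff e s hx).1 hs.continuousAt
  refine (hf.continuousAt.smul h1).congr ?_
  filter_upwards [e.open_baseSet.mem_nhds hx] with y hy
  exact ((he y hy).map_smul (f y) (s y)).symm

theorem isContinuousSection_zero : IsContinuousSection (0 : ∀ x, V.Fiber x) := by
  refine isContinuousSection_of_local fun n e he x hx => ?_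
  refine (continuousAt_const (y := (0 : Fin n → ℂ))).congr ?_
  filter_upwards [e.open_baseSet.mem_nhds hx] with y hy
  exact ((he y hy).map_zero).symm

theorem IsContinuousSection.form {β : V.Metric} {s t : ∀ x, V.Fiber x}
    (hs : IsContinuousSection s) (ht : IsContinuousSection t) :
    Continuous fun x => β.form (s x) (t x) := by
  have h : Continuous fun x =>
      (⟨x, (s x, t x)⟩ : TotalSpace (ℂ × ℂ) (V.Fiber ×ᵇ V.Fiber)) :=
    (FiberBundle.Prod.isInducing_diag ℂ V.Fiber ℂ V.Fiber).continuous_iff.2 (hs.prodMk ht)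
  exact β.continuous_inner.comp h

end Continuity

namespace Metric

variable (β : V.Metric) {x : X}

theorem form_add_right (a b c : V.Fiber x) : β.form a (b + c) = β.form a b + β.form a c := by
  let _ := β.core x
  exact InnerProductSpace.Core.inner_add_right a b c

theorem form_smul_right (a b : V.Fiber x) (r : ℂ) : β.form a (r • b) = r * β.form a b := by
  let _ := β.core x
  exact InnerProductSpace.Core.inner_smul_right a b

theorem form_conj (a b : V.Fiber x) : star (β.form a b) = β.form b a :=
  (β.core x).conj_inner_symm b a

theorem form_add_left (a b c : V.Fiber x) : β.form (a + b) c = β.form a c + β.form b c :=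
  (β.core x).add_left a b c

theorem form_smul_left (a b : V.Fiber x) (r : ℂ) : β.form (r • a) b = star r * β.form a b :=
  (β.core x).smul_left a b r

theorem form_self_nonneg (a : V.Fiber x) : 0 ≤ β.form a a := by
  have h1 : β.form a a = star (β.form a a) := (β.form_conj a a).symm
  have h2 : 0 ≤ (β.form a a).re := (β.core x).re_inner_nonneg a
  have h3 : (β.form a a).im = 0 := Complex.conj_eq_iff_im.1 h1.symm
  exact Complex.le_def.2 ⟨h2, h3.symm⟩

theorem form_self_eq_zero {a : V.Fiber x} : β.form a a = 0 ↔ a = 0 := by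
  refine ⟨(β.core x).definite a, ?_⟩
  rintro rfl
  have := β.form_smul_right (0 : V.Fiber x) 0 0
  simpa using this

theorem norm_form_sq_le (a b : V.Fiber x) :
    ‖β.form a b‖ ^ 2 ≤ ‖β.form a a‖ * ‖β.form b b‖ := by
  let _ := β.core x
  have h := InnerProductSpace.Core.inner_mul_inner_self_le (𝕜 := ℂ) a b
  have h1 : ‖β.form b a‖ = ‖β.form a b‖ := by rw [← β.form_conj a b, norm_star]
  calc ‖β.form a b‖ ^ 2 = ‖β.form a b‖ * ‖β.form b a‖ := by rw [h1]; ring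
    _ ≤ (β.form a a).re * (β.form b b).re := h
    _ ≤ _ := by
      have h2 : 0 ≤ (β.form b b).re := (β.core x).re_inner_nonneg b
      gcongr
      · exact Complex.re_le_norm _
      · exact Complex.re_le_norm _

end Metric

theorem tendsto_form_zero (β : V.Metric) {s t : ∀ x, V.Fiber x}
    (hs : Tendsto (fun x => β.form (s x) (s x)) (cocompact X) (𝓝 0))
    (ht : Tendsto (fun x => β.form (t x) (t x)) (cocompact X) (𝓝 0)) :
    Tendsto (fun x => β.form (s x) (t x)) (cocompact X) (𝓝 0) := by
  have h : Tendsto (fun x => √(‖β.form (s x) (s x)‖ * ‖β.form (t x) (t x)‖))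
      (cocompact X) (𝓝 0) := by
    have := (Real.continuous_sqrt.tendsto _).comp (hs.norm.mul ht.norm)
    simpa [Function.comp_def] using this
  exact squeeze_zero_norm (fun x => Real.le_sqrt_of_sq_le (β.norm_form_sq_le _ _)) h

/-- The space `Γ₀(V)` of continuous sections `s` of `V` vanishing at infinity, that is, such that
`β(s(x), s(x)) → 0` as `x → ∞`. -/
def sectionsC0 (V : ComplexVectorBundle.{u, w} X) (β : V.Metric) :
    Submodule ℂ (∀ x, V.Fiber x) where
  carrier := {s | IsContinuousSection s ∧
    Tendsto (fun x => β.form (s x) (s x)) (cocompact X) (𝓝 0)}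
  zero_mem' := ⟨isContinuousSection_zero, by
    simp only [Pi.zero_apply, β.form_self_eq_zero.2]
    exact tendsto_const_nhds⟩
  add_mem' := by
    rintro s t ⟨hs, hs0⟩ ⟨ht, ht0⟩
    refine ⟨hs.add ht, ?_⟩
    have hst := tendsto_form_zero β hs0 ht0
    have hts := tendsto_form_zero β ht0 hs0
    have := (hs0.add hst).add (hts.add ht0)
    simp only [add_zero] at this
    refine this.congr fun x => ?_
    rw [Pi.add_apply, β.form_add_left, β.form_add_right, β.form_add_right]
  smul_mem' := by
    rintro c s ⟨hs, hs0⟩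
    refine ⟨hs.smul continuous_const, ?_⟩
    have := hs0.const_mul (star c * c)
    rw [mul_zero] at this
    refine this.congr fun x => ?_
    rw [Pi.smul_apply, β.form_smul_left, β.form_smul_right, mul_assoc]

variable {β : V.Metric}

/-- The action `(f • s)(x) = f(x) s(x)` of `C₀(X)` on `Γ₀(V)`. -/
instance : SMul C₀(X, ℂ) (V.sectionsC0 β) where
  smul f s := ⟨fun x => f x • (s : ∀ x, V.Fiber x) x, s.2.1.smul f.continuous, by
    have h := ((zero_at_infty f).star.mul (zero_at_infty f)).mul s.2.2
    simp only [star_zero, mul_zero] at h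
    refine h.congr fun x => ?_
    rw [β.form_smul_left, β.form_smul_right, mul_assoc]⟩

theorem smul_apply (f : C₀(X, ℂ)) (s : V.sectionsC0 β) (x : X) :
    (f • s : V.sectionsC0 β).1 x = f x • s.1 x := rfl

/-- The inner product `⟨s, t⟩(x) = β(s(x), t(x))` on `Γ₀(V)`. -/
instance : Inner C₀(X, ℂ) (V.sectionsC0 β) where
  inner s t := ⟨⟨fun x => β.form (s.1 x) (t.1 x), s.2.1.form t.2.1⟩,
    tendsto_form_zero β s.2.2 t.2.2⟩

theorem inner_apply (s t : V.sectionsC0 β) (x : X) :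
    (inner C₀(X, ℂ) s t : C₀(X, ℂ)) x = β.form (s.1 x) (t.1 x) := rfl

/-- The norm on `Γ₀(V)` given by the inner product. -/
instance instNormSections : Norm (V.sectionsC0 β) := CStarModule.norm C₀(X, ℂ)

instance instCStarModuleSections : CStarModule C₀(X, ℂ) (V.sectionsC0 β) where
  inner_add_right {s t r} := by ext x; exact β.form_add_right _ _ _
  inner_self_nonneg {s} := fun x => β.form_self_nonneg _
  inner_self {s} := by
    constructor
    · intro h
      ext x
      exact β.form_self_eq_zero.1 (DFunLike.congr_fun h x)
    · rintro rfl
      ext x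
      exact β.form_self_eq_zero.2 rfl
  inner_op_smul_right {f s t} := by ext x; exact β.form_smul_right _ _ _
  inner_smul_right_complex {z s t} := by ext x; exact β.form_smul_right _ _ _
  star_inner s t := by ext x; exact β.form_conj _ _
  norm_eq_sqrt_norm_inner_self s := rfl

instance : NormedAddCommGroup (V.sectionsC0 β) :=
  NormedAddCommGroup.ofCore (CStarModule.normedSpaceCore C₀(X, ℂ))

instance : NormedSpace ℂ (V.sectionsC0 β) :=
  NormedSpace.ofCore (CStarModule.normedSpaceCore C₀(X, ℂ))

end ComplexVectorBundle

end

/-!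
For part (1), write `σ₁² + ⋯ + σₖ² = 1` on `K` with `σₐ` supported where `V` is trivial. The
coordinates and the frame of each trivialization, both cut off by `σₐ`, form a finite dual basis of
`Γ₀(V)_K`, which is therefore finitely generated and projective. Locally the metric
dominates the coordinates, so uniform limits of continuous sections are continuous, and `Γ₀(V)` is
complete.

For part (2), the fibre of `E` at `x` is `E` modulo the kernel of the form `⟨ξ, η⟩(x)`. Every
`ξ ∈ E` factors as `f • η` with `f` vanishing wherever `ξ` does, hence an element of `E_K` that
vanishes at `y ∈ K` lies in `I_y E_K`, where `I_y` is the maximal ideal of `y`. Finitely many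
elements with dense span generate `E_K` modulo each `I_y`, because the fibres are then
finite-dimensional; as the intersection of the `I_y` is zero, projectivity makes `E_K` finitely
generated. By Nakayama's lemma, elements of `E` that form a basis of one fibre span the nearby
fibres, and their Gram determinant shows that they stay linearly independent. These local frames
make the fibres a vector bundle. The map from `E` to its sections is isometric, and its image is
dense by a partition of unity.
-/

noncomputable section

/-! ### Projective modules and Gram matrices -/

section ProjectiveModule

variable {R M ι : Type*} [CommRing R] [AddCommGroup M] [Module R M] {I : ι → Ideal R}

theorem linearMap_eq_zero_of_le_ker_of_sup_smul_top_eq_top (hI : ⨅ i, I i = ⊥)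
    {N : Submodule R M} (hN : ∀ i, N ⊔ I i • ⊤ = ⊤) {φ : M →ₗ[R] R} (hφ : N ≤ LinearMap.ker φ) :
    φ = 0 := by
  have hrange (i : ι) : LinearMap.range φ ≤ I i := by
    rw [LinearMap.range_eq_map, ← hN i, Submodule.map_sup, Submodule.map_smul'',
      LinearMap.le_ker_iff_map.1 hφ, bot_sup_eq, smul_eq_mul]
    exact Ideal.mul_le_left
  ext m
  have hm : φ m ∈ ⨅ i, I i := Ideal.mem_iInf.2 fun i => hrange i ⟨m, rfl⟩
  simpa [hI] using hm

/-- A splitting of `M` into a free module has only finitely many nonzero coordinates: a coordinate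
that vanishes on the generators of `N` vanishes everywhere. -/
theorem finite_of_projective_of_sup_smul_top_eq_top [Module.Projective R M] (hI : ⨅ i, I i = ⊥)
    {N : Submodule R M} (hfg : N.FG) (hN : ∀ i, N ⊔ I i • ⊤ = ⊤) : Module.Finite R M := by
  classical
  obtain ⟨S, rfl⟩ := hfg
  obtain ⟨σ, hσ⟩ := Module.projective_def.1 ‹Module.Projective R M›
  let T : Finset M := S.biUnion fun s => (σ s).support
  have coord_eq_zero {m : M} (hm : m ∉ T) : Finsupp.lapply m ∘ₗ σ = 0 := by
    refine linearMap_eq_zero_of_le_ker_of_sup_smul_top_eq_top hI hN (Submodule.span_le.2 ?_)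
    intro s hs
    by_contra hne
    exact hm (Finset.mem_biUnion.2 ⟨s, hs, Finsupp.mem_support_iff.2 hne⟩)
  refine ⟨T, eq_top_iff.2 fun p _ => ?_⟩
  rw [← hσ p, Finsupp.linearCombination_apply]
  refine Submodule.sum_mem _ fun m hm => Submodule.smul_mem _ _ (Submodule.subset_span ?_)
  by_contra hmT
  exact Finsupp.mem_support_iff.1 hm (LinearMap.congr_fun (coord_eq_zero hmT) p)

end ProjectiveModule

section Gram

open Matrix

variable {𝕜 H ι : Type*} [RCLike 𝕜] [NormedAddCommGroup H] [InnerProductSpace 𝕜 H] [Fintype ι]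
  [DecidableEq ι]

/-- The vector in the span of a linearly independent family `b` whose inner products with the
members of `b` are prescribed, see `inner_gramVector`. -/
def gramVector (b : ι → H) (c : ι → 𝕜) : H :=
  ∑ i, ((gram 𝕜 b)⁻¹ *ᵥ c) i • b i

theorem inner_gramVector {b : ι → H} (hb : LinearIndependent 𝕜 b) (c : ι → 𝕜) (i : ι) :
    inner 𝕜 (b i) (gramVector b c) = c i := by
  have hdet : IsUnit (gram 𝕜 b).det := (det_gram_ne_zero_iff_linearIndependent.2 hb).isUnit
  calc inner 𝕜 (b i) (gramVector b c) = (gram 𝕜 b *ᵥ ((gram 𝕜 b)⁻¹ *ᵥ c)) i := by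
        simp only [gramVector, inner_sum, inner_smul_right, mulVec, dotProduct, gram_apply,
          mul_comm]
    _ = c i := by rw [mulVec_mulVec, mul_nonsing_inv _ hdet, one_mulVec]

theorem gramVector_inner {b : ι → H} (hb : LinearIndependent 𝕜 b)
    (hspan : Submodule.span 𝕜 (Set.range b) = ⊤) (v : H) :
    gramVector b (fun i => inner 𝕜 (b i) v) = v := by
  refine InnerProductSpace.ext_inner_left_basis (Module.Basis.mk hb hspan.ge) fun i => ?_
  rw [Module.Basis.coe_mk, inner_gramVector hb]

end Gram

/-! ### Partitions of unity and cut-off functions -/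

theorem exists_finset_partition {X : Type u} [TopologicalSpace X] [LocallyCompactSpace X]
    [T2Space X] {K : Set X} (hK : IsCompact K) {U : X → Set X} (hU : ∀ x, IsOpen (U x))
    (hxU : ∀ x, x ∈ U x) :
    ∃ (t : Finset X) (ρ : t → C(X, ℝ)), (∀ i, tsupport (ρ i) ⊆ U i) ∧
      (∀ i, HasCompactSupport (ρ i)) ∧ (∀ i y, 0 ≤ ρ i y) ∧ (∀ y, ∑ i, ρ i y ≤ 1) ∧
      ∀ y ∈ K, ∑ i, ρ i y = 1 := by
  obtain ⟨t, -, ht⟩ := hK.elim_nhds_subcover U fun x _ => (hU x).mem_nhds (hxU x)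
  have hcover : K ⊆ ⋃ i : t, U i := ht.trans_eq (Set.iUnion_subtype (· ∈ t) fun i => U i).symm
  obtain ⟨ρ, hρU, hρc⟩ := PartitionOfUnity.exists_isSubordinate_of_locallyFinite_t2space hK
    (fun i : t => U i) (fun i => hU i) (locallyFinite_of_finite _) hcover
  simp only [← finsum_eq_sum_of_fintype]
  exact ⟨t, ρ, hρU, hρc, ρ.nonneg, ρ.sum_le_one, fun y hy => ρ.sum_eq_one hy⟩

/-- A compactly supported real function as an element of `C₀(X)`. -/
def C0.ofReal {X : Type u} [TopologicalSpace X] (ρ : C(X, ℝ)) (hρ : HasCompactSupport ρ) :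
    C₀(X, ℂ) :=
  ⟨⟨fun x => (ρ x : ℂ), Complex.continuous_ofReal.comp ρ.continuous⟩,
    HasCompactSupport.is_zero_at_infty
      (hρ.comp_left (g := fun t : ℝ => (t : ℂ)) Complex.ofReal_zero)⟩

@[simp] theorem C0.ofReal_apply {X : Type u} [TopologicalSpace X] (ρ : C(X, ℝ))
    (hρ : HasCompactSupport ρ) (x : X) : C0.ofReal ρ hρ x = ρ x := rfl

namespace HilbertC0

/-! ### The fibres of a Hilbert `C₀(X)`-module -/

section Fiber

variable {X : Type u} [TopologicalSpace X] {E : Type v} [NormedAddCommGroup E] [NormedSpace ℂ E]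
  [SMul C₀(X, ℂ) E] [CStarModule C₀(X, ℂ) E]

/-- The space `E` with the semi-inner product `⟨ξ, η⟩(x)`; a type synonym, since `E` carries its
own norm. -/
def PreFiber {X : Type u} [TopologicalSpace X] (E : Type v) [NormedAddCommGroup E]
    [NormedSpace ℂ E] [SMul C₀(X, ℂ) E] [CStarModule C₀(X, ℂ) E] (_x : X) : Type v := E

instance (x : X) : AddCommGroup (PreFiber E x) := inferInstanceAs (AddCommGroup E)

instance (x : X) : Module ℂ (PreFiber E x) := inferInstanceAs (Module ℂ E)

variable (E) in
/-- The semi-inner product `⟨ξ, η⟩(x)` on `E`. -/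
@[reducible] def preFiberCore (x : X) : PreInnerProductSpace.Core ℂ (PreFiber E x) where
  inner ξ η := (inner C₀(X, ℂ) (show E from ξ) (show E from η) : C₀(X, ℂ)) x
  conj_inner_symm ξ η := by
    rw [← CStarModule.star_inner (A := C₀(X, ℂ)) (show E from η) (show E from ξ)]
    rfl
  re_inner_nonneg ξ := (Complex.le_def.1
    ((CStarModule.inner_self_nonneg (A := C₀(X, ℂ)) (x := (show E from ξ)) :) x)).1
  add_left ξ η ζ := DFunLike.congr_fun
    (CStarModule.inner_add_left (A := C₀(X, ℂ)) (x := (show E from ξ)) (y := (show E from η))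
      (z := (show E from ζ))) x
  smul_left ξ η r := DFunLike.congr_fun
    (CStarModule.inner_smul_left_complex (A := C₀(X, ℂ)) (z := r) (x := (show E from ξ))
      (y := (show E from η))) x

instance (x : X) : SeminormedAddCommGroup (PreFiber E x) :=
  @InnerProductSpace.Core.toSeminormedAddCommGroup ℂ _ _ _ _ (preFiberCore E x)

instance (x : X) : InnerProductSpace ℂ (PreFiber E x) :=
  InnerProductSpace.ofCore (preFiberCore E x)

variable (E) in
/-- The fibre of `E` at `x`: the Hausdorff inner product space associated with `⟨ξ, η⟩(x)`. -/
abbrev Fiber (x : X) : Type v := SeparationQuotient (PreFiber E x)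

/-- The value of `ξ ∈ E` at `x`. -/
def evalAt (x : X) : E →ₗ[ℂ] Fiber E x where
  toFun ξ := SeparationQuotient.mk (X := PreFiber E x) ξ
  map_add' _ _ := rfl
  map_smul' _ _ := rfl

theorem evalAt_surjective (x : X) : Function.Surjective (evalAt (E := E) x) :=
  SeparationQuotient.surjective_mk (X := PreFiber E x)

theorem inner_evalAt (x : X) (ξ η : E) :
    inner ℂ (evalAt x ξ) (evalAt x η) = (inner C₀(X, ℂ) ξ η : C₀(X, ℂ)) x := rfl

theorem norm_evalAt_sq (x : X) (ξ : E) :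
    ‖evalAt x ξ‖ ^ 2 = ‖(inner C₀(X, ℂ) ξ ξ : C₀(X, ℂ)) x‖ := by
  rw [← inner_evalAt, inner_self_eq_norm_sq_to_K, norm_pow]
  simp

theorem norm_evalAt (x : X) (ξ : E) :
    ‖evalAt x ξ‖ = √‖(inner C₀(X, ℂ) ξ ξ : C₀(X, ℂ)) x‖ := by
  rw [← norm_evalAt_sq, Real.sqrt_sq (norm_nonneg _)]

theorem norm_evalAt_le (x : X) (ξ : E) : ‖evalAt x ξ‖ ≤ ‖ξ‖ := by
  rw [norm_evalAt, CStarModule.norm_eq_sqrt_norm_inner_self (A := C₀(X, ℂ)) ξ]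
  exact Real.sqrt_le_sqrt (norm_apply_le _ _)

theorem continuous_norm_evalAt (ξ : E) : Continuous fun x : X => ‖evalAt x ξ‖ := by
  simp only [norm_evalAt]
  fun_prop

theorem tendsto_norm_evalAt_cocompact (ξ : E) :
    Tendsto (fun x : X => ‖evalAt x ξ‖) (cocompact X) (𝓝 0) := by
  simpa only [norm_evalAt, norm_zero, Real.sqrt_zero] using
    (zero_at_infty (inner C₀(X, ℂ) ξ ξ : C₀(X, ℂ))).norm.sqrt

theorem uniformContinuous_evalAt (x : X) : UniformContinuous (evalAt (E := E) x) :=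
  AddMonoidHomClass.uniformContinuous_of_bound _ 1 fun ξ => by
    simpa using norm_evalAt_le x ξ

theorem norm_le_of_forall_evalAt {ξ : E} {c : ℝ} (hc : 0 ≤ c)
    (h : ∀ x : X, ‖evalAt x ξ‖ ≤ c) : ‖ξ‖ ≤ c := by
  rw [CStarModule.norm_eq_sqrt_norm_inner_self (A := C₀(X, ℂ)) ξ]
  refine Real.sqrt_le_iff.2 ⟨hc, norm_le_of_forall (by positivity) fun x => ?_⟩
  rw [← norm_evalAt_sq]
  exact pow_le_pow_left₀ (norm_nonneg _) (h x) 2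

theorem evalAt_smul (x : X) (f : C₀(X, ℂ)) (ξ : E) : evalAt x (f • ξ) = f x • evalAt x ξ := by
  refine ext_inner_left ℂ fun v => ?_
  obtain ⟨η, rfl⟩ := evalAt_surjective x v
  rw [inner_evalAt, CStarModule.inner_op_smul_right, inner_smul_right, inner_evalAt]
  rfl

theorem IsFull.nontrivial_fiber [LocallyCompactSpace X] [T2Space X] (h : IsFull X E) (x : X) :
    Nontrivial (Fiber E x) := by
  by_contra hx
  rw [not_nontrivial_iff_subsingleton] at hx
  let evalX : C₀(X, ℂ) →ₗ[ℂ] ℂ :=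
    { toFun f := f x, map_add' _ _ := rfl, map_smul' _ _ := rfl }
  have hcont : Continuous evalX :=
    AddMonoidHomClass.continuous_of_bound evalX 1 fun f =>
      (norm_apply_le f x).trans_eq (one_mul ‖f‖).symm
  have hspan : Submodule.span ℂ (Set.range fun p : E × E => inner C₀(X, ℂ) p.1 p.2)
      ≤ LinearMap.ker evalX := by
    refine Submodule.span_le.2 ?_
    rintro _ ⟨p, rfl⟩
    change (inner C₀(X, ℂ) p.1 p.2 : C₀(X, ℂ)) x = 0
    rw [← inner_evalAt, Subsingleton.elim (evalAt x p.1) 0, inner_zero_left]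
  have hzero (f : C₀(X, ℂ)) : f x = 0 :=
    closure_minimal hspan (isClosed_singleton.preimage hcont) (h ▸ Set.mem_univ f)
  obtain ⟨f, hf⟩ := exists_extension ⟨{x}, isCompact_singleton⟩ 1
  exact one_ne_zero ((hf ⟨x, rfl⟩).symm.trans (hzero f))

end Fiber

/-! ### Factorization -/

section Factorization

variable {X : Type u} [TopologicalSpace X] {E : Type v} [NormedAddCommGroup E] [NormedSpace ℂ E]
  [SMul C₀(X, ℂ) E] [CStarModule C₀(X, ℂ) E]

/-- The function `x ↦ φ(‖ξ(x)‖)` in `C₀(X)`, for a continuous function `φ` with `φ(0) = 0`. -/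
def normComp (ξ : E) (φ : C(ℝ, ℝ)) (h0 : φ 0 = 0) : C₀(X, ℂ) where
  toFun x := (φ ‖evalAt x ξ‖ : ℂ)
  continuous_toFun :=
    Complex.continuous_ofReal.comp (φ.continuous.comp (continuous_norm_evalAt ξ))
  zero_at_infty' := by
    have h := ((Complex.continuous_ofReal.comp φ.continuous).tendsto 0).comp
      (tendsto_norm_evalAt_cocompact (X := X) ξ)
    simpa only [Function.comp_def, h0, Complex.ofReal_zero] using h

theorem evalAt_normComp_smul (ξ η : E) {φ : C(ℝ, ℝ)} (h0 : φ 0 = 0) (x : X) :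
    evalAt x ((normComp ξ φ h0 : C₀(X, ℂ)) • η) = φ ‖evalAt x ξ‖ • evalAt x η :=
  evalAt_smul x _ η

/-- The function `√r / (r + δ)` on `r ≥ 0`; as `δ → 0`, its multiple by `r` tends to `√r`
uniformly. -/
def sqrtDivAdd (δ : ℝ) (hδ : 0 < δ) : C(ℝ, ℝ) where
  toFun r := √r / (|r| + δ)
  continuous_toFun := Real.continuous_sqrt.div (by fun_prop) fun r => by positivity

theorem sqrtDivAdd_zero {δ : ℝ} (hδ : 0 < δ) : sqrtDivAdd δ hδ 0 = 0 := by
  simp [sqrtDivAdd]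

theorem sqrtDivAdd_apply {δ r : ℝ} (hδ : 0 < δ) (hr : 0 ≤ r) :
    sqrtDivAdd δ hδ r = √r / (r + δ) := by
  simp [sqrtDivAdd, abs_of_nonneg hr]

theorem abs_sqrtDivAdd_mul_sub_le {r δ : ℝ} (hr : 0 ≤ r) (hδ : 0 < δ) :
    |sqrtDivAdd δ hδ r * r - √r| ≤ √δ := by
  have h1 : √r / (r + δ) * r - √r = -(√r * δ / (r + δ)) := by field_simp; ring
  rw [sqrtDivAdd_apply hδ hr, h1, abs_neg, abs_of_nonneg (by positivity),
    div_le_iff₀ (by positivity)]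
  have amgm : √r * √δ ≤ r + δ := by
    nlinarith [sq_nonneg (√r - √δ), Real.sq_sqrt hr, Real.sq_sqrt hδ.le]
  calc √r * δ = √δ * (√r * √δ) := by linear_combination -√r * Real.sq_sqrt hδ.le
    _ ≤ √δ * (r + δ) := by gcongr

theorem abs_sqrt_mul_sqrtDivAdd_mul_sub_le {r δ : ℝ} (hr : 0 ≤ r) (hδ : 0 < δ) :
    |√r * sqrtDivAdd δ hδ r * r - r| ≤ δ := by
  have h1 : √r * (√r / (r + δ)) * r - r = -(r * δ / (r + δ)) := by
    rw [mul_div_assoc', Real.mul_self_sqrt hr]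
    field_simp
    ring
  rw [sqrtDivAdd_apply hδ hr, h1, abs_neg, abs_of_nonneg (by positivity),
    div_le_iff₀ (by positivity)]
  nlinarith

variable (X) in
/-- The approximations `√‖ξ(x)‖ / (‖ξ(x)‖ + δ) • ξ(x)` to `ξ(x) / √‖ξ(x)‖`. -/
def approxRoot (ξ : E) (δ : ℝ) (hδ : 0 < δ) : E :=
  (normComp ξ (sqrtDivAdd δ hδ) (sqrtDivAdd_zero hδ) : C₀(X, ℂ)) • ξ

theorem norm_approxRoot_sub_le (ξ : E) {δ ε : ℝ} (hδ : 0 < δ) (hε : 0 < ε) :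
    ‖approxRoot X ξ δ hδ - approxRoot X ξ ε hε‖ ≤ √δ + √ε := by
  refine norm_le_of_forall_evalAt (X := X) (by positivity) fun x => ?_
  have hr := norm_nonneg (evalAt x ξ)
  rw [approxRoot, approxRoot, map_sub, evalAt_normComp_smul, evalAt_normComp_smul, ← sub_smul,
    norm_smul, Real.norm_eq_abs, ← abs_of_nonneg hr, ← abs_mul, abs_norm, sub_mul]
  calc _ ≤ |_ - √‖evalAt x ξ‖| + |√‖evalAt x ξ‖ - _| := abs_sub_le _ _ _
    _ ≤ √δ + √ε := by
      rw [abs_sub_comm (√_)]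
      exact add_le_add (abs_sqrtDivAdd_mul_sub_le hr hδ) (abs_sqrtDivAdd_mul_sub_le hr hε)

theorem norm_normComp_sqrt_smul_approxRoot_sub_le (ξ : E) {δ : ℝ} (hδ : 0 < δ) :
    ‖(normComp ξ ⟨_, Real.continuous_sqrt⟩ Real.sqrt_zero : C₀(X, ℂ)) • approxRoot X ξ δ hδ - ξ‖
      ≤ δ := by
  refine norm_le_of_forall_evalAt (X := X) hδ.le fun x => ?_
  have hr := norm_nonneg (evalAt x ξ)
  have heval : evalAt x
      ((normComp ξ ⟨_, Real.continuous_sqrt⟩ Real.sqrt_zero : C₀(X, ℂ)) • approxRoot X ξ δ hδ - ξ)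
      = (√‖evalAt x ξ‖ * sqrtDivAdd δ hδ ‖evalAt x ξ‖ - 1) • evalAt x ξ := by
    rw [map_sub, evalAt_normComp_smul, approxRoot, evalAt_normComp_smul, sub_smul, mul_smul,
      one_smul]
    rfl
  rw [heval, norm_smul, Real.norm_eq_abs, ← abs_of_nonneg hr, ← abs_mul, abs_norm, sub_mul,
    one_mul]
  exact abs_sqrt_mul_sqrtDivAdd_mul_sub_le hr hδ

theorem exists_eq_smul [CompleteSpace E] (ξ : E) :
    ∃ (f : C₀(X, ℂ)) (η : E), (∀ x, evalAt x ξ = 0 → f x = 0) ∧ ξ = f • η := by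
  let δ : ℕ → ℝ := fun n => 1 / ((n : ℝ) + 1)
  have hδ (n : ℕ) : 0 < δ n := by positivity
  have hδ0 : Tendsto δ atTop (𝓝 0) := tendsto_one_div_add_atTop_nhds_zero_nat
  have hcauchy : CauchySeq fun n => approxRoot X ξ (δ n) (hδ n) := by
    refine cauchySeq_of_le_tendsto_0' (fun n => √(δ n) + √(δ n)) (fun n m hnm => ?_)
      (by simpa using hδ0.sqrt.add hδ0.sqrt)
    rw [dist_eq_norm]
    have hmn : δ m ≤ δ n := one_div_le_one_div_of_le (by positivity) (by gcongr)
    exact (norm_approxRoot_sub_le ξ (hδ n) (hδ m)).trans (by gcongr)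
  obtain ⟨η, hη⟩ := cauchySeq_tendsto_of_complete hcauchy
  let f : C₀(X, ℂ) := normComp ξ ⟨_, Real.continuous_sqrt⟩ Real.sqrt_zero
  refine ⟨f, η, fun x hx => ?_, tendsto_nhds_unique ?_ (((smulCLM f).continuous.tendsto η).comp hη)⟩
  · change ((√‖evalAt x ξ‖ : ℝ) : ℂ) = 0
    rw [hx, norm_zero, Real.sqrt_zero, Complex.ofReal_zero]
  · rw [tendsto_iff_norm_sub_tendsto_zero]
    exact squeeze_zero (fun _ => norm_nonneg _)
      (fun n => norm_normComp_sqrt_smul_approxRoot_sub_le ξ (hδ n)) hδ0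

end Factorization

end HilbertC0

/-! ### A density criterion -/

theorem norm_sub_sum_smul_le {ι H : Type*} [Fintype ι] [NormedAddCommGroup H] [NormedSpace ℝ H]
    {ρ : ι → ℝ} (hρ0 : ∀ i, 0 ≤ ρ i) (hρ1 : ∑ i, ρ i ≤ 1) {v : H} {w : ι → H} {ε : ℝ}
    (hw : ∀ i, ρ i ≠ 0 → ‖v - w i‖ ≤ ε) (hv : ∑ i, ρ i ≠ 1 → ‖v‖ ≤ ε) :
    ‖v - ∑ i, ρ i • w i‖ ≤ ε := by
  have hsplit : v - ∑ i, ρ i • w i = ∑ i, ρ i • (v - w i) + (1 - ∑ i, ρ i) • v := by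
    simp only [smul_sub, Finset.sum_sub_distrib, ← Finset.sum_smul, sub_smul, one_smul]
    abel
  have hterm (i : ι) : ‖ρ i • (v - w i)‖ ≤ ρ i * ε := by
    rw [norm_smul, Real.norm_of_nonneg (hρ0 i)]
    rcases eq_or_ne (ρ i) 0 with hi | hi
    · simp [hi]
    · exact mul_le_mul_of_nonneg_left (hw i hi) (hρ0 i)
  have hrest : ‖(1 - ∑ i, ρ i) • v‖ ≤ (1 - ∑ i, ρ i) * ε := by
    rw [norm_smul, Real.norm_of_nonneg (sub_nonneg.2 hρ1)]
    rcases eq_or_ne (∑ i, ρ i) 1 with hsum | hsum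
    · simp [hsum]
    · exact mul_le_mul_of_nonneg_left (hv hsum) (sub_nonneg.2 hρ1)
  calc ‖v - ∑ i, ρ i • w i‖ ≤ ∑ i, ‖ρ i • (v - w i)‖ + ‖(1 - ∑ i, ρ i) • v‖ := by
        rw [hsplit]
        exact (norm_add_le _ _).trans (by gcongr; exact norm_sum_le _ _)
    _ ≤ ∑ i, ρ i * ε + (1 - ∑ i, ρ i) * ε :=
        add_le_add (Finset.sum_le_sum fun i _ => hterm i) hrest
    _ = ε := by rw [← Finset.sum_mul]; ring

namespace HilbertC0

theorem dense_of_forall_exists_evalAt_eq {X : Type u} [TopologicalSpace X] [LocallyCompactSpace X]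
    [T2Space X] {E : Type v} [NormedAddCommGroup E] [NormedSpace ℂ E] [SMul C₀(X, ℂ) E]
    [CStarModule C₀(X, ℂ) E] {W : Submodule ℂ E}
    (hsmul : ∀ (f : C₀(X, ℂ)), ∀ ξ ∈ W, f • ξ ∈ W)
    (heval : ∀ (ξ : E) (x : X), ∃ η ∈ W, evalAt x η = evalAt x ξ) : Dense (W : Set E) := by
  refine fun ξ => Metric.mem_closure_iff.2 fun ε hε => ?_
  choose η hηW hη using heval ξ
  let U : X → Set X := fun x => {y | ‖evalAt y (ξ - η x)‖ < ε / 2}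
  have hU (x : X) : IsOpen (U x) := isOpen_lt (continuous_norm_evalAt _) continuous_const
  have hxU (x : X) : x ∈ U x := by simpa [U, hη] using hε
  obtain ⟨K, hK, hKξ⟩ := mem_cocompact.1 <|
    (tendsto_norm_evalAt_cocompact (X := X) ξ).eventually_lt_const (half_pos hε)
  obtain ⟨t, ρ, hρU, hρc, hρ0, hρ1, hρK⟩ := exists_finset_partition hK hU hxU
  refine ⟨∑ i, C0.ofReal (ρ i) (hρc i) • η i,
    W.sum_mem fun i _ => hsmul _ _ (hηW i), lt_of_le_of_lt ?_ (half_lt_self hε)⟩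
  rw [dist_eq_norm]
  refine norm_le_of_forall_evalAt (X := X) (half_pos hε).le fun y => ?_
  simp only [map_sub, map_sum, evalAt_smul, C0.ofReal_apply, Complex.coe_smul]
  refine norm_sub_sum_smul_le (fun i => hρ0 i y) (hρ1 y) (fun i hi => ?_) fun hy => ?_
  · rw [← map_sub]
    exact (hρU i (subset_tsupport _ hi)).le
  · exact (hKξ fun hyK => hy (hρK y hyK)).le

end HilbertC0

namespace HilbertC0

/-! ### The fibres of the restrictions to compact sets -/

section RestrictionEval

variable {X : Type u} [TopologicalSpace X] [LocallyCompactSpace X] [T2Space X]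
  {E : Type v} [NormedAddCommGroup E] [NormedSpace ℂ E] [SMul C₀(X, ℂ) E] [CStarModule C₀(X, ℂ) E]
  {K : TopologicalSpace.Compacts X}

/-- Evaluation at `y`, the ring homomorphism over which evaluating elements of `E_K` is
semilinear. -/
abbrev evalHom (y : K) : C(K, ℂ) →+* ℂ := (ContinuousMap.evalAlgHom ℂ ℂ y).toRingHom

instance (y : K) : RingHomSurjective (evalHom y) where
  is_surjective c := ⟨ContinuousMap.const K c, rfl⟩

/-- The value of an element of `E_K` at a point of `K`. -/
def Restriction.evalAt (y : K) : Restriction E K →ₛₗ[evalHom y] Fiber E (y : X) where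
  toFun := (idealSubmodule E K).liftQ (HilbertC0.evalAt (y : X)) fun ζ hζ => by
    rw [LinearMap.mem_ker, ← inner_self_eq_zero (𝕜 := ℂ), inner_evalAt]
    exact inner_apply_eq_zero hζ ζ y.2
  map_add' := map_add _
  map_smul' g q := by
    obtain ⟨ξ, rfl⟩ := Restriction.mk_surjective q
    obtain ⟨f, hf⟩ := exists_extension K g
    rw [Restriction.smul_mk hf]
    change HilbertC0.evalAt (y : X) (f • ξ) = g y • HilbertC0.evalAt (y : X) ξ
    rw [evalAt_smul, hf]

@[simp] theorem Restriction.evalAt_mk (y : K) (ξ : E) :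
    Restriction.evalAt y (Restriction.mk K ξ) = HilbertC0.evalAt (y : X) ξ := rfl

theorem Restriction.evalAt_smul (y : K) (g : C(K, ℂ)) (q : Restriction E K) :
    Restriction.evalAt y (g • q) = g y • Restriction.evalAt y q :=
  map_smulₛₗ (Restriction.evalAt y) g q

theorem Restriction.evalAt_surjective (y : K) :
    Function.Surjective (Restriction.evalAt (E := E) y) := fun v => by
  obtain ⟨ξ, rfl⟩ := HilbertC0.evalAt_surjective (y : X) v
  exact ⟨Restriction.mk K ξ, rfl⟩

theorem Restriction.norm_evalAt_le (y : K) (q : Restriction E K) :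
    ‖Restriction.evalAt y q‖ ≤ ‖q‖ := by
  obtain ⟨ξ, rfl⟩ := Restriction.mk_surjective q
  rw [evalAt_mk, norm_evalAt, Restriction.norm_mk]
  exact Real.sqrt_le_sqrt ((restrict K (inner C₀(X, ℂ) ξ ξ)).norm_coe_le_norm y)

theorem Restriction.continuous_evalAt (y : K) : Continuous (Restriction.evalAt (E := E) y) :=
  AddMonoidHomClass.continuous_of_bound _ 1 fun q => by simpa using norm_evalAt_le y q

theorem Restriction.ext_evalAt {p q : Restriction E K}
    (h : ∀ y, Restriction.evalAt y p = Restriction.evalAt y q) : p = q := by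
  obtain ⟨ξ, hξ⟩ := Restriction.mk_surjective (p - q)
  have hzero : restrict K (inner C₀(X, ℂ) ξ ξ) = 0 := by
    ext y
    change (inner C₀(X, ℂ) ξ ξ : C₀(X, ℂ)) y = 0
    rw [← inner_evalAt, ← Restriction.evalAt_mk, hξ, map_sub, h, sub_self, inner_zero_left]
  rw [← sub_eq_zero, ← hξ, ← norm_eq_zero, Restriction.norm_mk, hzero, norm_zero, Real.sqrt_zero]

theorem Restriction.ker_evalAt_le [CompleteSpace E] (y : K) :
    LinearMap.ker (Restriction.evalAt (E := E) y) ≤ RingHom.ker (evalHom y) • ⊤ := by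
  intro q hq
  obtain ⟨ξ, rfl⟩ := Restriction.mk_surjective q
  obtain ⟨f, η, hf, rfl⟩ := exists_eq_smul (X := X) ξ
  rw [← Restriction.smul_mk (g := restrict K f) fun _ => rfl]
  exact Submodule.smul_mem_smul (hf y hq) trivial

theorem Restriction.sup_ker_evalHom_smul_top [CompleteSpace E] {y : K}
    {N : Submodule C(K, ℂ) (Restriction E K)} (hN : N.map (Restriction.evalAt y) = ⊤) :
    N ⊔ RingHom.ker (evalHom y) • ⊤ = ⊤ := by
  have hker : N ⊔ LinearMap.ker (Restriction.evalAt y) = ⊤ := by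
    rw [← Submodule.comap_map_eq, hN, Submodule.comap_top]
  exact eq_top_iff.2 (hker.ge.trans (sup_le_sup_left (ker_evalAt_le y) N))

theorem Restriction.map_evalAt_span_eq_top {S : Set (Restriction E K)} (hfin : S.Finite)
    (hS : Dense (Submodule.span C(K, ℂ) S : Set (Restriction E K))) (y : K) :
    (Submodule.span C(K, ℂ) S).map (Restriction.evalAt y) = ⊤ := by
  have hdense : Dense ((Submodule.span C(K, ℂ) S).map (Restriction.evalAt y) : Set (Fiber E y.1)) :=
    (evalAt_surjective y).denseRange.dense_image (continuous_evalAt y) hS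
  have hfinite : FiniteDimensional ℂ ((Submodule.span C(K, ℂ) S).map (Restriction.evalAt y)) := by
    rw [Submodule.map_span]
    exact FiniteDimensional.span_of_finite ℂ (hfin.image _)
  rw [← Submodule.dense_iff_topologicalClosure_eq_top.1 hdense]
  exact ((Submodule.closed_of_finiteDimensional _).submodule_topologicalClosure_eq).symm

theorem Restriction.finite_of_projective [CompleteSpace E]
    [Module.Projective C(K, ℂ) (Restriction E K)] {S : Set (Restriction E K)} (hfin : S.Finite)
    (hS : Dense (Submodule.span C(K, ℂ) S : Set (Restriction E K))) :
    Module.Finite C(K, ℂ) (Restriction E K) := by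
  have hI : ⨅ y : K, RingHom.ker (evalHom y) = ⊥ := by
    refine eq_bot_iff.2 fun g hg => ?_
    ext y
    exact (Ideal.mem_iInf.1 hg) y
  exact finite_of_projective_of_sup_smul_top_eq_top hI (Submodule.fg_span hfin) fun y =>
    sup_ker_evalHom_smul_top (map_evalAt_span_eq_top hfin hS y)

end RestrictionEval

/-! ### Local frames -/

section LocalFrame

variable {X : Type u} [TopologicalSpace X] {E : Type v} [NormedAddCommGroup E] [NormedSpace ℂ E]
  [SMul C₀(X, ℂ) E] [CStarModule C₀(X, ℂ) E] {n : ℕ}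

/-- The values of `m₁, …, mₙ ∈ E` are a basis of every fibre over the open set `U`. -/
structure IsFrameOn (m : Fin n → E) (U : Set X) : Prop where
  isOpen : IsOpen U
  linearIndependent : ∀ y ∈ U, LinearIndependent ℂ fun i => evalAt y (m i)
  span_eq_top : ∀ y ∈ U, Submodule.span ℂ (Set.range fun i => evalAt y (m i)) = ⊤

theorem continuous_gram_evalAt (m : Fin n → E) :
    Continuous fun y : X => Matrix.gram ℂ fun i => evalAt y (m i) :=
  continuous_matrix fun i j => (inner C₀(X, ℂ) (m i) (m j) : C₀(X, ℂ)).continuous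

theorem eventually_linearIndependent_evalAt {m : Fin n → E} {x : X}
    (hm : LinearIndependent ℂ fun i => evalAt x (m i)) :
    ∀ᶠ y in 𝓝 x, LinearIndependent ℂ fun i => evalAt y (m i) := by
  simp only [← Matrix.det_gram_ne_zero_iff_linearIndependent (𝕜 := ℂ)] at hm ⊢
  exact (continuous_gram_evalAt m).matrix_det.continuousAt.eventually_ne hm

variable [LocallyCompactSpace X] [T2Space X] [CompleteSpace E]

theorem eventually_span_evalAt_eq_top {K : TopologicalSpace.Compacts X}
    [Module.Finite C(K, ℂ) (Restriction E K)] {x : X} (hKx : (K : Set X) ∈ 𝓝 x) {m : Fin n → E}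
    (hm : Submodule.span ℂ (Set.range fun i => evalAt x (m i)) = ⊤) :
    ∀ᶠ y in 𝓝 x, Submodule.span ℂ (Set.range fun i => evalAt y (m i)) = ⊤ := by
  let N : Submodule C(K, ℂ) (Restriction E K) :=
    Submodule.span C(K, ℂ) (Set.range fun i => Restriction.mk K (m i))
  have hmap (y : K) : N.map (Restriction.evalAt y) =
      Submodule.span ℂ (Set.range fun i => evalAt (y : X) (m i)) := by
    rw [Submodule.map_span, ← Set.range_comp]
    rfl
  obtain ⟨r, hr1, hrN⟩ := Submodule.exists_sub_one_mem_and_smul_le_of_fg_of_le_sup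
    Module.Finite.fg_top le_rfl
    (Restriction.sup_ker_evalHom_smul_top ((hmap ⟨x, mem_of_mem_nhds hKx⟩).trans hm)).ge
  obtain ⟨f, hf⟩ := exists_extension K r
  have hfx : f x = 1 := (hf ⟨x, mem_of_mem_nhds hKx⟩).trans (sub_eq_zero.1 hr1)
  have hfne : ∀ᶠ y in 𝓝 x, f y ≠ 0 :=
    f.continuous.continuousAt.eventually_ne (hfx.trans_ne one_ne_zero)
  filter_upwards [hKx, hfne] with y hyK hfy
  refine eq_top_iff.2 fun v _ => ?_
  obtain ⟨q, rfl⟩ := Restriction.evalAt_surjective (E := E) ⟨y, hyK⟩ v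
  rw [← Submodule.smul_mem_iff _ hfy, hf ⟨y, hyK⟩, ← hmap ⟨y, hyK⟩,
    ← Restriction.evalAt_smul]
  exact Submodule.mem_map_of_mem (hrN (Submodule.smul_mem_pointwise_smul q r ⊤ trivial))

theorem exists_isFrameOn (hfg : IsSigmaFinitelyGenerated X E) (hproj : IsSigmaProjective X E)
    (x : X) : ∃ (n : ℕ) (m : Fin n → E) (U : Set X), x ∈ U ∧ IsFrameOn m U := by
  obtain ⟨K, hKc, hKx⟩ := exists_compact_mem_nhds x
  lift K to TopologicalSpace.Compacts X using hKc
  obtain ⟨S, hS⟩ := hfg K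
  have := hproj K
  have : Module.Finite C(K, ℂ) (Restriction E K) :=
    Restriction.finite_of_projective S.finite_toSet hS
  have : FiniteDimensional ℂ (Fiber E x) :=
    Module.Finite.of_surjective _ (Restriction.evalAt_surjective ⟨x, mem_of_mem_nhds hKx⟩)
  let b := Module.finBasis ℂ (Fiber E x)
  choose m hm using fun i => evalAt_surjective x (b i)
  have hspan : Submodule.span ℂ (Set.range fun i => evalAt x (m i)) = ⊤ := by
    simpa only [hm] using b.span_eq
  have hli : LinearIndependent ℂ fun i => evalAt x (m i) := by
    simpa only [hm] using b.linearIndependent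
  obtain ⟨U, hU, hUo, hxU⟩ := mem_nhds_iff.1 <|
    (eventually_linearIndependent_evalAt hli).and (eventually_span_evalAt_eq_top hKx hspan)
  exact ⟨_, m, U, hxU, hUo, fun y hy => (hU hy).1, fun y hy => (hU hy).2⟩

end LocalFrame

end HilbertC0

theorem ComplexVectorBundle.evalAt_eq_evalAt_iff {X : Type u} [TopologicalSpace X]
    {V : ComplexVectorBundle.{u, w} X} {β : V.Metric} {x : X} {s t : V.sectionsC0 β} :
    HilbertC0.evalAt x s = HilbertC0.evalAt x t ↔ s.1 x = t.1 x := by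
  rw [← sub_eq_zero, ← map_sub, ← inner_self_eq_zero (𝕜 := ℂ), HilbertC0.inner_evalAt,
    inner_apply, β.form_self_eq_zero]
  exact sub_eq_zero

/-! ### The vector bundle of a Hilbert `C₀(X)`-module -/

namespace HilbertC0

section Bundle

variable {X : Type u} [TopologicalSpace X] {E : Type v} [NormedAddCommGroup E] [NormedSpace ℂ E]
  [SMul C₀(X, ℂ) E] [CStarModule C₀(X, ℂ) E]

/-- The inner product of a vector in a fibre with the value of `ξ`. -/
def innerWith (ξ : E) (p : TotalSpace ℂ (Fiber E : X → Type v)) : ℂ :=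
  inner ℂ (evalAt p.proj ξ) p.2

/-- The base point of a vector in a fibre, and its inner products with all elements of `E`. -/
def innerProfile (p : TotalSpace ℂ (Fiber E : X → Type v)) : X × (E → ℂ) :=
  (p.proj, fun ξ => innerWith ξ p)

/-- The weakest topology for which the projection and the inner products with elements of `E` are
continuous. -/
instance : TopologicalSpace (TotalSpace ℂ (Fiber E : X → Type v)) :=
  TopologicalSpace.induced innerProfile inferInstance

theorem isInducing_innerProfile :
    IsInducing (innerProfile : TotalSpace ℂ (Fiber E : X → Type v) → X × (E → ℂ)) := ⟨rfl⟩

theorem continuous_proj_fiber : Continuous (π ℂ (Fiber E : X → Type v)) :=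
  continuous_fst.comp isInducing_innerProfile.continuous

theorem continuous_innerWith (ξ : E) : Continuous (innerWith (X := X) ξ) :=
  (continuous_apply ξ).comp (continuous_snd.comp isInducing_innerProfile.continuous)

namespace IsFrameOn

variable {n : ℕ} {m : Fin n → E} {U : Set X}

theorem continuousOn_gram_inv (h : IsFrameOn m U) :
    ContinuousOn (fun y : X => (Matrix.gram ℂ fun i => evalAt y (m i))⁻¹) U := fun y hy => by
  have hdet := (Matrix.det_gram_ne_zero_iff_linearIndependent (𝕜 := ℂ)).2 (h.linearIndependent y hy)
  exact ((continuousAt_matrix_inv _ (by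
    simpa using NormedRing.inverse_continuousAt (Units.mk0 _ hdet))).comp
      (continuous_gram_evalAt m).continuousAt).continuousWithinAt

theorem continuousOn_gram_inv_mulVec (h : IsFrameOn m U) :
    ContinuousOn (fun q : X × (Fin n → ℂ) =>
      (Matrix.gram ℂ fun i => evalAt q.1 (m i))⁻¹.mulVec q.2) (U ×ˢ Set.univ) := by
  rw [continuousOn_iff_continuous_domRestrict]
  exact (continuousOn_iff_continuous_domRestrict.1
    (h.continuousOn_gram_inv.comp continuousOn_fst fun q hq => hq.1)).matrix_mulVec
    (continuous_snd.comp continuous_subtype_val)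

/-- The base point of a vector in a fibre, and its inner products with the members of a frame. -/
def innerFrame (m : Fin n → E) (p : TotalSpace ℂ (Fiber E : X → Type v)) : X × (Fin n → ℂ) :=
  (p.proj, fun i => innerWith (m i) p)

theorem continuous_innerFrame (m : Fin n → E) : Continuous (innerFrame (X := X) m) :=
  continuous_proj_fiber.prodMk (continuous_pi fun i => continuous_innerWith (m i))

theorem continuousOn_gramVector (h : IsFrameOn m U) :
    ContinuousOn (fun q : X × (Fin n → ℂ) =>
      (⟨q.1, gramVector (fun i => evalAt q.1 (m i)) q.2⟩ : TotalSpace ℂ (Fiber E : X → Type v)))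
      (U ×ˢ Set.univ) := by
  refine isInducing_innerProfile.continuousOn_iff.2
    (continuousOn_fst.prodMk (continuousOn_pi.2 fun ξ => ?_))
  simp only [innerWith, gramVector, inner_sum, inner_smul_right, inner_evalAt]
  refine continuousOn_finsetSum _ fun i _ => ContinuousOn.mul ?_ ?_
  · exact (continuous_apply i).comp_continuousOn h.continuousOn_gram_inv_mulVec
  · exact ((inner C₀(X, ℂ) ξ (m i) : C₀(X, ℂ)).continuous.comp continuous_fst).continuousOn

/-- The local trivialization of the bundle of fibres given by a frame. The coordinates of a vector
are its inner products with the frame, not its coefficients. -/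
def trivialization (h : IsFrameOn m U) :
    Trivialization (Fin n → ℂ) (π ℂ (Fiber E : X → Type v)) where
  toFun := innerFrame m
  invFun q := ⟨q.1, gramVector (fun i => evalAt q.1 (m i)) q.2⟩
  source := π ℂ (Fiber E : X → Type v) ⁻¹' U
  target := U ×ˢ Set.univ
  map_source' _ hp := ⟨hp, trivial⟩
  map_target' _ hq := hq.1
  left_inv' p hp := congrArg (TotalSpace.mk p.proj)
    (gramVector_inner (h.linearIndependent _ hp) (h.span_eq_top _ hp) p.2)
  right_inv' q hq := congrArg (Prod.mk q.1)
    (funext fun i => inner_gramVector (h.linearIndependent _ hq.1) q.2 i)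
  open_source := h.isOpen.preimage continuous_proj_fiber
  open_target := h.isOpen.prod isOpen_univ
  continuousOn_toFun := (continuous_innerFrame m).continuousOn
  continuousOn_invFun := h.continuousOn_gramVector
  baseSet := U
  open_baseSet := h.isOpen
  source_eq := rfl
  target_eq := rfl
  proj_toFun _ _ := rfl

theorem inner_eq_dotProduct (h : IsFrameOn m U) {y : X} (hy : y ∈ U) (v w : Fiber E y) :
    inner ℂ v w = star ((Matrix.gram ℂ fun i => evalAt y (m i))⁻¹.mulVec (innerFrame m ⟨y, v⟩).2)
      ⬝ᵥ (innerFrame m ⟨y, w⟩).2 := by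
  conv_lhs => rw [← gramVector_inner (h.linearIndependent y hy) (h.span_eq_top y hy) v]
  simp only [gramVector, sum_inner, inner_smul_left]
  rfl

theorem continuousOn_inner (h : IsFrameOn m U) :
    ContinuousOn (fun q : TotalSpace (ℂ × ℂ) ((Fiber E : X → Type v) ×ᵇ (Fiber E : X → Type v)) =>
      (inner ℂ q.2.1 q.2.2 : ℂ)) (TotalSpace.proj ⁻¹' U) := by
  have hdiag := (FiberBundle.Prod.isInducing_diag ℂ (Fiber E : X → Type v) ℂ
    (Fiber E : X → Type v)).continuous
  have hfst := (continuous_innerFrame m).comp (continuous_fst.comp hdiag)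
  have hsnd := (continuous_innerFrame m).comp (continuous_snd.comp hdiag)
  have hmaps : Set.MapsTo (fun q : TotalSpace (ℂ × ℂ)
      ((Fiber E : X → Type v) ×ᵇ (Fiber E : X → Type v)) => innerFrame m ⟨q.proj, q.2.1⟩)
      (TotalSpace.proj ⁻¹' U) (U ×ˢ Set.univ) := fun q hq => ⟨hq, trivial⟩
  have hcoeff := continuousOn_iff_continuous_domRestrict.1 <|
    h.continuousOn_gram_inv_mulVec.comp hfst.continuousOn hmaps
  refine ContinuousOn.congr (continuousOn_iff_continuous_domRestrict.2 ?_)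
    fun q hq => h.inner_eq_dotProduct hq q.2.1 q.2.2
  exact hcoeff.star.dotProduct (continuous_snd.comp (hsnd.comp continuous_subtype_val))

end IsFrameOn

variable (X E) in
/-- The fibres of `E` are nonzero and have frames around every point of `X`, so that they form a
vector bundle. -/
class HasLocalFrames : Prop where
  nontrivial_fiber : ∀ x : X, Nontrivial (Fiber E x)
  exists_isFrameOn : ∀ x : X, ∃ (n : ℕ) (m : Fin n → E) (U : Set X), x ∈ U ∧ IsFrameOn m U

variable [HasLocalFrames X E]

variable (X E) in
theorem continuous_inner_fiber :
    Continuous fun q : TotalSpace (ℂ × ℂ) ((Fiber E : X → Type v) ×ᵇ (Fiber E : X → Type v)) =>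
      (inner ℂ q.2.1 q.2.2 : ℂ) := by
  have hproj : Continuous (TotalSpace.proj :
      TotalSpace (ℂ × ℂ) ((Fiber E : X → Type v) ×ᵇ (Fiber E : X → Type v)) → X) :=
    continuous_proj_fiber.comp (continuous_fst.comp
      (FiberBundle.Prod.isInducing_diag ℂ (Fiber E : X → Type v) ℂ _).continuous)
  refine continuous_iff_continuousAt.2 fun q => ?_
  obtain ⟨n, m, U, hx, h⟩ := HasLocalFrames.exists_isFrameOn (E := E) q.proj
  exact h.continuousOn_inner.continuousAt ((h.isOpen.preimage hproj).mem_nhds hx)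

variable (X E) in
/-- The vector bundle whose fibres are the fibres of `E`. -/
def toBundle : ComplexVectorBundle.{u, v} X where
  Fiber := Fiber E
  nontrivial := HasLocalFrames.nontrivial_fiber
  locally_trivial x := by
    obtain ⟨n, m, U, hx, h⟩ := HasLocalFrames.exists_isFrameOn (E := E) x
    exact ⟨n, h.trivialization, hx, fun y _ =>
      { map_add := fun a b => funext fun i => inner_add_right _ _ _
        map_smul := fun c a => funext fun i => inner_smul_right _ _ _ }⟩

variable (X E) in
/-- The metric on the bundle of `E` given by the inner products of the fibres. -/
def toMetric : (toBundle X E).Metric where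
  core x := (InnerProductSpace.toCore : InnerProductSpace.Core ℂ (Fiber E x))
  continuous_inner := continuous_inner_fiber X E

variable (X) in
/-- The section of the bundle of `E` given by an element of `E`. -/
def toSection : E →ₗ[ℂ] (toBundle X E).sectionsC0 (toMetric X E) where
  toFun ξ := ⟨fun x => evalAt x ξ,
    isInducing_innerProfile.continuous_iff.2
      (continuous_id.prodMk (continuous_pi fun η => (inner C₀(X, ℂ) η ξ : C₀(X, ℂ)).continuous)),
    zero_at_infty (inner C₀(X, ℂ) ξ ξ : C₀(X, ℂ))⟩
  map_add' ξ η := by ext x; exact map_add _ _ _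
  map_smul' c ξ := by ext x; exact map_smul _ _ _

theorem toSection_smul (f : C₀(X, ℂ)) (ξ : E) : toSection X (f • ξ) = f • toSection X ξ :=
  Subtype.ext (funext fun x => evalAt_smul x f ξ)

theorem inner_toSection (ξ η : E) :
    inner C₀(X, ℂ) (toSection X ξ) (toSection X η) = inner C₀(X, ℂ) ξ η := rfl

theorem norm_toSection (ξ : E) : ‖toSection X ξ‖ = ‖ξ‖ := by
  rw [CStarModule.norm_eq_sqrt_norm_inner_self (A := C₀(X, ℂ)), inner_toSection,
    ← CStarModule.norm_eq_sqrt_norm_inner_self]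

variable [LocallyCompactSpace X] [T2Space X]

theorem dense_range_toSection :
    Dense (LinearMap.range (toSection (E := E) X) :
      Set ((toBundle X E).sectionsC0 (toMetric X E))) := by
  refine dense_of_forall_exists_evalAt_eq (X := X) ?_ fun s x => ?_
  · rintro f _ ⟨ξ, rfl⟩
    exact ⟨f • ξ, toSection_smul f ξ⟩
  · obtain ⟨ξ, hξ⟩ := evalAt_surjective (E := E) x (s.1 x)
    exact ⟨_, ⟨ξ, rfl⟩, ComplexVectorBundle.evalAt_eq_evalAt_iff.2 hξ⟩

theorem toSection_bijective [CompleteSpace E] : Function.Bijective (toSection (E := E) X) := by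
  have hiso : Isometry (toSection (E := E) X) := AddMonoidHomClass.isometry_of_norm _ norm_toSection
  refine ⟨hiso.injective, Set.range_eq_univ.1 ?_⟩
  rw [← hiso.isClosedEmbedding.isClosed_range.closure_eq]
  exact dense_range_toSection.closure_eq

end Bundle

theorem exists_bundle {X : Type u} [TopologicalSpace X] [LocallyCompactSpace X] [T2Space X]
    {E : Type v} [NormedAddCommGroup E] [NormedSpace ℂ E] [SMul C₀(X, ℂ) E]
    [CStarModule C₀(X, ℂ) E] [CompleteSpace E] (hfull : IsFull X E)
    (hfg : IsSigmaFinitelyGenerated X E) (hproj : IsSigmaProjective X E) :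
    ∃ (V : ComplexVectorBundle.{u, v} X) (β : V.Metric) (T : E ≃ₗ[ℂ] V.sectionsC0 β),
      (∀ (f : C₀(X, ℂ)) (ξ : E), T (f • ξ) = f • T ξ) ∧
      ∀ ξ η : E, inner C₀(X, ℂ) (T ξ) (T η) = inner C₀(X, ℂ) ξ η :=
  have : HasLocalFrames X E := ⟨hfull.nontrivial_fiber, exists_isFrameOn hfg hproj⟩
  ⟨toBundle X E, toMetric X E, LinearEquiv.ofBijective (toSection X) toSection_bijective,
    toSection_smul, inner_toSection⟩

end HilbertC0

/-- A family of functionals on the fibres over `K` that is continuous along the elements of `E`, as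
a `C(K)`-linear functional on `E_K`. -/
def HilbertC0.Restriction.ofFunctionals {X : Type u} [TopologicalSpace X] [LocallyCompactSpace X]
    [T2Space X] {E : Type v} [NormedAddCommGroup E] [NormedSpace ℂ E] [SMul C₀(X, ℂ) E]
    [CStarModule C₀(X, ℂ) E] {K : TopologicalSpace.Compacts X}
    (φ : ∀ y : K, Fiber E (y : X) →ₗ[ℂ] ℂ)
    (hφ : ∀ ξ : E, Continuous fun y : K => φ y (HilbertC0.evalAt (y : X) ξ)) :
    Restriction E K →ₗ[C(K, ℂ)] C(K, ℂ) where
  toFun q := ⟨fun y => φ y (Restriction.evalAt y q), by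
    obtain ⟨ξ, rfl⟩ := Restriction.mk_surjective q
    exact hφ ξ⟩
  map_add' p q := by
    ext y
    exact (congrArg (φ y) (map_add (Restriction.evalAt y) p q)).trans (map_add _ _ _)
  map_smul' g q := by
    ext y
    exact (congrArg (φ y) (Restriction.evalAt_smul y g q)).trans (map_smul _ _ _)

/-! ### Local coordinates of a vector bundle -/

namespace ComplexVectorBundle

section LocalCoordinates

variable {X : Type u} [TopologicalSpace X] {V : ComplexVectorBundle.{u, w} X} {n : ℕ}
  {e : Trivialization (Fin n → ℂ) (π ℂ V.Fiber)}

/-- The local trivialization `e` is linear on the fibres. Mathlib's `Trivialization.IsLinear` does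
not apply, since the model fibre is not the dummy argument `ℂ` of `TotalSpace`. -/
def IsFiberwiseLinear (e : Trivialization (Fin n → ℂ) (π ℂ V.Fiber)) : Prop :=
  ∀ y ∈ e.baseSet, IsLinearMap ℂ fun v : V.Fiber y => (e ⟨y, v⟩).2

theorem bijective_trivialization_snd {y : X} (hy : y ∈ e.baseSet) :
    Function.Bijective fun v : V.Fiber y => (e ⟨y, v⟩).2 := by
  refine ⟨fun a b hab => ?_, fun c => ?_⟩
  · have h := (e.preimageSingletonHomeomorph hy).injective
      (a₁ := ⟨⟨y, a⟩, rfl⟩) (a₂ := ⟨⟨y, b⟩, rfl⟩) hab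
    exact TotalSpace.mk_injective y (congrArg Subtype.val h)
  · obtain ⟨⟨⟨z, v⟩, hz⟩, hv⟩ := (e.preimageSingletonHomeomorph hy).surjective c
    obtain rfl : z = y := hz
    exact ⟨v, hv⟩

namespace IsFiberwiseLinear

/-- The coordinates in a fibre over the base set of `e`. -/
def coordEquiv (he : IsFiberwiseLinear e) {y : X} (hy : y ∈ e.baseSet) :
    V.Fiber y ≃ₗ[ℂ] (Fin n → ℂ) :=
  LinearEquiv.ofBijective ((he y hy).mk' _) (bijective_trivialization_snd hy)

open Classical in
/-- The coordinates in the fibre at `y`, or zero if `y` is not in the base set of `e`. -/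
def coord (he : IsFiberwiseLinear e) (y : X) : V.Fiber y →ₗ[ℂ] (Fin n → ℂ) :=
  if hy : y ∈ e.baseSet then he.coordEquiv hy else 0

open Classical in
/-- The vector in the fibre at `y` with given coordinates, or zero if `y` is not in the base set of
`e`. -/
def ofCoord (he : IsFiberwiseLinear e) (y : X) : (Fin n → ℂ) →ₗ[ℂ] V.Fiber y :=
  if hy : y ∈ e.baseSet then (he.coordEquiv hy).symm else 0

variable (he : IsFiberwiseLinear e)

theorem coord_apply {y : X} (hy : y ∈ e.baseSet) (v : V.Fiber y) :
    he.coord y v = (e ⟨y, v⟩).2 := by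
  rw [coord, dif_pos hy]
  rfl

theorem ofCoord_coord {y : X} (hy : y ∈ e.baseSet) (v : V.Fiber y) :
    he.ofCoord y (he.coord y v) = v := by
  rw [coord, ofCoord, dif_pos hy, dif_pos hy]
  exact (he.coordEquiv hy).symm_apply_apply v

theorem coord_ofCoord {y : X} (hy : y ∈ e.baseSet) (c : Fin n → ℂ) :
    he.coord y (he.ofCoord y c) = c := by
  rw [coord, ofCoord, dif_pos hy, dif_pos hy]
  exact (he.coordEquiv hy).apply_symm_apply c

theorem continuousAt_section_iff_coord (s : ∀ x, V.Fiber x) {x : X} (hx : x ∈ e.baseSet) :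
    ContinuousAt (fun y => (⟨y, s y⟩ : TotalSpace ℂ V.Fiber)) x ↔
      ContinuousAt (fun y => he.coord y (s y)) x := by
  rw [continuousAt_section_iff e s hx]
  refine continuousAt_congr ?_
  filter_upwards [e.open_baseSet.mem_nhds hx] with y hy
  exact (he.coord_apply hy (s y)).symm

variable {σ : C(X, ℝ)}

/-- The `i`-th coordinate, cut off by `σ`. -/
def cutOffCoord (σ : C(X, ℝ)) (i : Fin n) (y : X) : V.Fiber y →ₗ[ℂ] ℂ :=
  (σ y : ℂ) • (LinearMap.proj i ∘ₗ he.coord y)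

/-- The `i`-th member of the local frame given by `e`, cut off by `σ`. -/
def cutOffFrame (σ : C(X, ℝ)) (i : Fin n) (y : X) : V.Fiber y :=
  (σ y : ℂ) • he.ofCoord y (Pi.single i 1)

theorem continuous_cutOffCoord (hσ : tsupport σ ⊆ e.baseSet) (i : Fin n) {s : ∀ x, V.Fiber x}
    (hs : IsContinuousSection s) : Continuous fun y => he.cutOffCoord σ i y (s y) := by
  have hsupp : Function.support (fun y => he.cutOffCoord σ i y (s y)) ⊆ Function.support σ :=
    fun y hy h0 => hy (by simp [cutOffCoord, h0])
  refine ContinuousOn.continuous_of_tsupport_subset (fun y hy => ?_) e.open_baseSet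
    ((closure_mono hsupp).trans hσ)
  exact ((Complex.continuous_ofReal.comp σ.continuous).continuousAt.mul (continuousAt_pi.1
    ((he.continuousAt_section_iff_coord s hy).1 hs.continuousAt) i)).continuousWithinAt

theorem isContinuousSection_cutOffFrame (hσ : tsupport σ ⊆ e.baseSet) (i : Fin n) :
    IsContinuousSection (he.cutOffFrame σ i) := by
  refine continuous_iff_continuousAt.2 fun y => ?_
  by_cases hy : y ∈ tsupport σ
  · refine (he.continuousAt_section_iff_coord _ (hσ hy)).2 ?_
    have hcont : Continuous fun y => (σ y : ℂ) • (Pi.single i 1 : Fin n → ℂ) :=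
      (Complex.continuous_ofReal.comp σ.continuous).smul continuous_const
    refine hcont.continuousAt.congr ?_
    filter_upwards [e.open_baseSet.mem_nhds (hσ hy)] with z hz
    rw [cutOffFrame, map_smul, he.coord_ofCoord hz]
  · refine (isContinuousSection_zero (V := V)).continuousAt.congr ?_
    filter_upwards [(isClosed_tsupport σ).isOpen_compl.mem_nhds hy] with z hz
    simp [cutOffFrame, image_eq_zero_of_notMem_tsupport hz]

theorem cutOffFrame_mem_sectionsC0 (β : V.Metric) (hσ : tsupport σ ⊆ e.baseSet)
    (hc : HasCompactSupport σ) (i : Fin n) : he.cutOffFrame σ i ∈ V.sectionsC0 β := by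
  refine ⟨he.isContinuousSection_cutOffFrame hσ i, tendsto_const_nhds.congr' ?_⟩
  filter_upwards [hc.isCompact.compl_mem_cocompact] with y hy
  rw [cutOffFrame, image_eq_zero_of_notMem_tsupport hy, Complex.ofReal_zero, zero_smul,
    β.form_self_eq_zero.2 rfl]

theorem sum_cutOffCoord_smul_cutOffFrame (hσ : tsupport σ ⊆ e.baseSet) {y : X} (v : V.Fiber y) :
    ∑ i, he.cutOffCoord σ i y v • he.cutOffFrame σ i y = (σ y ^ 2 : ℂ) • v := by
  by_cases hy : y ∈ tsupport σ
  · have hexpand : v = ∑ i, he.coord y v i • he.ofCoord y (Pi.single i 1) := by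
      conv_lhs => rw [← he.ofCoord_coord (hσ hy) v, pi_eq_sum_univ' (he.coord y v), map_sum]
      simp only [map_smul]
    conv_rhs => rw [hexpand, Finset.smul_sum]
    refine Finset.sum_congr rfl fun i _ => ?_
    simp only [cutOffCoord, cutOffFrame, LinearMap.smul_apply, LinearMap.comp_apply,
      LinearMap.proj_apply, smul_eq_mul, smul_smul]
    ring_nf
  · simp [cutOffFrame, image_eq_zero_of_notMem_tsupport hy]

end IsFiberwiseLinear

end LocalCoordinates

/-! ### The module of sections of a vector bundle -/

section Fiber

variable {X : Type u} [TopologicalSpace X] {V : ComplexVectorBundle.{u, w} X} {β : V.Metric}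

open HilbertC0

variable (β) in
/-- The fibre at `x` of the Hilbert module `Γ₀(V)`, mapped into the fibre of `V` by sending the
value of a section in the former to its value in the latter. -/
def ofFiber (x : X) : HilbertC0.Fiber (V.sectionsC0 β) x →ₗ[ℂ] V.Fiber x :=
  (LinearMap.ker (evalAt x)).liftQ (LinearMap.proj x ∘ₗ (V.sectionsC0 β).subtype)
    (fun _ hs => evalAt_eq_evalAt_iff.1 (hs.trans (map_zero (evalAt x)).symm)) ∘ₗ
  ((evalAt x).quotKerEquivOfSurjective (evalAt_surjective x)).symm.toLinearMap

@[simp] theorem ofFiber_evalAt (x : X) (s : V.sectionsC0 β) : ofFiber β x (evalAt x s) = s.1 x := by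
  have h : ((evalAt x).quotKerEquivOfSurjective (evalAt_surjective x)).symm (evalAt x s) =
      (LinearMap.ker (evalAt (E := V.sectionsC0 β) x)).mkQ s := by
    rw [LinearEquiv.symm_apply_eq]
    rfl
  rw [ofFiber, LinearMap.comp_apply, LinearEquiv.coe_coe, h]
  rfl

theorem ofFiber_injective (x : X) : Function.Injective (ofFiber β x) := fun a b hab => by
  obtain ⟨s, rfl⟩ := evalAt_surjective x a
  obtain ⟨t, rfl⟩ := evalAt_surjective x b
  rw [ofFiber_evalAt, ofFiber_evalAt] at hab
  exact evalAt_eq_evalAt_iff.2 hab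

end Fiber

section Restriction

variable {X : Type u} [TopologicalSpace X] [LocallyCompactSpace X] [T2Space X]
  {V : ComplexVectorBundle.{u, w} X} (β : V.Metric)

open HilbertC0

variable (V) in
theorem exists_finset_trivialization (K : TopologicalSpace.Compacts X) :
    ∃ (t : Finset X) (n : t → ℕ) (e : ∀ a, Trivialization (Fin (n a) → ℂ) (π ℂ V.Fiber))
      (σ : t → C(X, ℝ)), (∀ a, IsFiberwiseLinear (e a)) ∧ (∀ a, tsupport (σ a) ⊆ (e a).baseSet) ∧
      (∀ a, HasCompactSupport (σ a)) ∧ ∀ y ∈ K, ∑ a, σ a y ^ 2 = 1 := by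
  choose n e hx he using V.locally_trivial
  obtain ⟨t, ρ, hρe, hρc, hρ0, -, hρK⟩ :=
    exists_finset_partition K.isCompact (fun x => (e x).open_baseSet) hx
  let σ (a : t) : C(X, ℝ) := ⟨fun y => √(ρ a y), (ρ a).continuous.sqrt⟩
  have hsupp (a : t) : tsupport (σ a) ⊆ tsupport (ρ a) :=
    closure_mono fun y hy h0 => hy (by simp [σ, h0])
  have hsq (a : t) (y : X) : σ a y ^ 2 = ρ a y := Real.sq_sqrt (hρ0 a y)
  refine ⟨t, fun a => n a, fun a => e a, σ, fun a => he a, fun a => (hsupp a).trans (hρe a),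
    fun a => (hρc a).isCompact.of_isClosed_subset (isClosed_tsupport _) (hsupp a), fun y hy => ?_⟩
  simpa only [hsq] using hρK y hy

theorem exists_dual_basis (K : TopologicalSpace.Compacts X) : ∃ (ι : Type u) (_ : Fintype ι)
    (m : ι → Restriction (V.sectionsC0 β) K)
    (φ : ι → Restriction (V.sectionsC0 β) K →ₗ[C(K, ℂ)] C(K, ℂ)),
    ∀ q, ∑ i, φ i q • m i = q := by
  obtain ⟨t, n, e, σ, he, hσe, hσc, hσK⟩ := exists_finset_trivialization V K
  let b (j : Σ a : t, Fin (n a)) : V.sectionsC0 β :=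
    ⟨_, (he j.1).cutOffFrame_mem_sectionsC0 β (hσe j.1) (hσc j.1) j.2⟩
  let φ (j : Σ a : t, Fin (n a)) : Restriction (V.sectionsC0 β) K →ₗ[C(K, ℂ)] C(K, ℂ) :=
    Restriction.ofFunctionals (fun y => (he j.1).cutOffCoord (σ j.1) j.2 y ∘ₗ ofFiber β y)
      fun s => by
        simp only [LinearMap.comp_apply, ofFiber_evalAt]
        exact ((he j.1).continuous_cutOffCoord (hσe j.1) j.2 s.2.1).comp continuous_subtype_val
  refine ⟨_, inferInstance, fun j => Restriction.mk K (b j), φ,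
    fun q => Restriction.ext_evalAt fun y => ?_⟩
  obtain ⟨s, rfl⟩ := Restriction.mk_surjective q
  have hφ (j : Σ a : t, Fin (n a)) : φ j (Restriction.mk K s) y =
      (he j.1).cutOffCoord (σ j.1) j.2 y (s.1 y) :=
    congrArg ((he j.1).cutOffCoord (σ j.1) j.2 y) (ofFiber_evalAt (y : X) s)
  have hone : ∑ a, (σ a y ^ 2 : ℂ) = 1 := by exact_mod_cast hσK y y.2
  apply ofFiber_injective
  simp only [map_sum, Restriction.evalAt_smul, hφ, map_smul, Restriction.evalAt_mk, ofFiber_evalAt,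
    b, Fintype.sum_sigma, (he _).sum_cutOffCoord_smul_cutOffFrame (hσe _)]
  rw [← Finset.sum_smul, hone, one_smul]

theorem isSigmaFinitelyGenerated_sectionsC0 : IsSigmaFinitelyGenerated X (V.sectionsC0 β) := by
  classical
  intro K
  obtain ⟨ι, _, m, φ, h⟩ := exists_dual_basis β K
  refine ⟨Finset.univ.image m, ?_⟩
  have hspan : Submodule.span C(K, ℂ) (Set.range m) = ⊤ := eq_top_iff.2 fun q _ => by
    rw [← h q]
    exact Submodule.sum_mem _ fun i _ =>
      Submodule.smul_mem _ _ (Submodule.subset_span (Set.mem_range_self i))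
  rw [Finset.coe_image, Finset.coe_univ, Set.image_univ, hspan]
  exact dense_univ

theorem isSigmaProjective_sectionsC0 : IsSigmaProjective X (V.sectionsC0 β) := by
  intro K
  obtain ⟨ι, _, m, φ, h⟩ := exists_dual_basis β K
  refine Module.Projective.of_split (LinearMap.pi φ) (Fintype.linearCombination C(K, ℂ) m) ?_
  ext q
  simpa [Fintype.linearCombination_apply] using h q

end Restriction

end ComplexVectorBundle

/-! ### Completeness of the module of sections -/

section FiberwiseLimit

variable {X : Type u} [TopologicalSpace X] {E : Type v} [NormedAddCommGroup E] [NormedSpace ℂ E]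
  [SMul C₀(X, ℂ) E] [CStarModule C₀(X, ℂ) E]

theorem HilbertC0.exists_fiberwise_limit [∀ x : X, CompleteSpace (Fiber E x)] {u : ℕ → E}
    (hu : CauchySeq u) : ∃ v : ∀ x : X, Fiber E x,
      ∀ ε > 0, ∀ᶠ n in atTop, ∀ x, ‖evalAt x (u n) - v x‖ ≤ ε := by
  choose v hv using fun x : X =>
    cauchySeq_tendsto_of_complete ((uniformContinuous_evalAt x).comp_cauchySeq hu)
  refine ⟨v, fun ε hε => ?_⟩
  obtain ⟨N, hN⟩ := Metric.cauchySeq_iff.1 hu ε hε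
  filter_upwards [eventually_ge_atTop N] with n hn x
  refine le_of_tendsto (tendsto_const_nhds.sub (hv x)).norm ?_
  filter_upwards [eventually_ge_atTop N] with m hm
  calc ‖evalAt x (u n) - evalAt x (u m)‖ = ‖evalAt x (u n - u m)‖ := by rw [map_sub]
    _ ≤ ‖u n - u m‖ := norm_evalAt_le x _
    _ ≤ ε := (dist_eq_norm (u n) (u m) ▸ hN n hn m hm).le

theorem HilbertC0.tendsto_norm_cocompact_of_approx {v : ∀ x : X, Fiber E x}
    (hv : ∀ ε > 0, ∃ ξ : E, ∀ x, ‖evalAt x ξ - v x‖ ≤ ε) :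
    Tendsto (fun x => ‖v x‖) (cocompact X) (𝓝 0) := by
  refine Metric.tendsto_nhds.2 fun ε hε => ?_
  obtain ⟨ξ, hξ⟩ := hv (ε / 2) (half_pos hε)
  filter_upwards [(tendsto_norm_evalAt_cocompact ξ).eventually_lt_const (half_pos hε)] with x hx
  rw [dist_zero_right, norm_norm]
  linarith [norm_le_insert (evalAt x ξ) (v x), hξ x]

end FiberwiseLimit

namespace ComplexVectorBundle

variable {X : Type u} [TopologicalSpace X] {V : ComplexVectorBundle.{u, w} X}

section UniformApproximation

variable {n : ℕ} {e : Trivialization (Fin n → ℂ) (π ℂ V.Fiber)}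

theorem norm_form_smul_self (β : V.Metric) {x : X} (r : ℂ) (v : V.Fiber x) :
    ‖β.form (r • v) (r • v)‖ = ‖r‖ ^ 2 * ‖β.form v v‖ := by
  rw [β.form_smul_left, β.form_smul_right, norm_mul, norm_mul, norm_star]
  ring

namespace IsFiberwiseLinear

variable (he : IsFiberwiseLinear e)

theorem mk_ofCoord {y : X} (hy : y ∈ e.baseSet) (c : Fin n → ℂ) :
    (⟨y, he.ofCoord y c⟩ : TotalSpace ℂ V.Fiber) = e.toOpenPartialHomeomorph.symm (y, c) := by
  have hsource : (⟨y, he.ofCoord y c⟩ : TotalSpace ℂ V.Fiber) ∈ e.source := e.mem_source.2 hy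
  have he_mk : e ⟨y, he.ofCoord y c⟩ = (y, c) := Prod.ext (e.coe_fst hsource)
    ((he.coord_apply hy _).symm.trans (he.coord_ofCoord hy c))
  rw [← he_mk]
  exact (e.left_inv hsource).symm

theorem continuousAt_form_ofCoord (β : V.Metric) {x : X} (hx : x ∈ e.baseSet) (c : Fin n → ℂ) :
    ContinuousAt (fun p : X × (Fin n → ℂ) => β.form (he.ofCoord p.1 p.2) (he.ofCoord p.1 p.2))
      (x, c) := by
  have hmk : ContinuousAt
      (fun p : X × (Fin n → ℂ) => (⟨p.1, he.ofCoord p.1 p.2⟩ : TotalSpace ℂ V.Fiber)) (x, c) := by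
    refine (e.toOpenPartialHomeomorph.continuousAt_symm (e.mem_target.2 hx)).congr ?_
    filter_upwards [continuousAt_fst (e.open_baseSet.mem_nhds hx)] with p hp
    exact (he.mk_ofCoord hp p.2).symm
  have hdiag : ContinuousAt (fun p : X × (Fin n → ℂ) =>
      (⟨p.1, (he.ofCoord p.1 p.2, he.ofCoord p.1 p.2)⟩ :
        TotalSpace (ℂ × ℂ) (V.Fiber ×ᵇ V.Fiber))) (x, c) :=
    (FiberBundle.Prod.isInducing_diag ℂ V.Fiber ℂ V.Fiber).continuousAt_iff.2 (hmk.prodMk hmk)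
  exact β.continuous_inner.continuousAt.comp hdiag

theorem exists_pos_eventually_le_norm_form_ofCoord (β : V.Metric) {x : X} (hx : x ∈ e.baseSet) :
    ∃ δ > 0, ∀ᶠ y in 𝓝 x, ∀ c ∈ Metric.sphere (0 : Fin n → ℂ) 1,
      δ ≤ ‖β.form (he.ofCoord y c) (he.ofCoord y c)‖ := by
  have hpos : ∀ c ∈ Metric.sphere (0 : Fin n → ℂ) 1,
      0 < ‖β.form (he.ofCoord x c) (he.ofCoord x c)‖ := fun c hc => by
    rw [norm_pos_iff, Ne, β.form_self_eq_zero]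
    intro h0
    have hc0 : c = 0 := by rw [← he.coord_ofCoord hx c, h0, map_zero]
    exact ne_zero_of_mem_unit_sphere ⟨c, hc⟩ hc0
  have hcont : Continuous fun c => ‖β.form (he.ofCoord x c) (he.ofCoord x c)‖ :=
    (continuous_iff_continuousAt.2 fun c => (he.continuousAt_form_ofCoord β hx c).comp
      (f := fun c => (x, c)) (by fun_prop)).norm
  obtain ⟨m, hm, hle⟩ :=
    (isCompact_sphere (0 : Fin n → ℂ) 1).exists_forall_le' hcont.continuousOn hpos
  refine ⟨m / 2, half_pos hm, (isCompact_sphere 0 1).eventually_forall_of_forall_eventually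
    fun c hc => ?_⟩
  exact ((he.continuousAt_form_ofCoord β hx c).norm.eventually_const_lt
    ((half_lt_self hm).trans_le (hle c hc))).mono fun _ h => h.le

theorem exists_pos_eventually_mul_norm_coord_sq_le (β : V.Metric) {x : X} (hx : x ∈ e.baseSet) :
    ∃ δ > 0, ∀ᶠ y in 𝓝 x, ∀ v : V.Fiber y, δ * ‖he.coord y v‖ ^ 2 ≤ ‖β.form v v‖ := by
  obtain ⟨δ, hδ, hle⟩ := he.exists_pos_eventually_le_norm_form_ofCoord β hx
  refine ⟨δ, hδ, ?_⟩
  filter_upwards [hle, e.open_baseSet.mem_nhds hx] with y hsphere hy v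
  rcases eq_or_ne (he.coord y v) 0 with h0 | h0
  · simp [h0]
  have hv : v = (‖he.coord y v‖ : ℂ) • he.ofCoord y ((‖he.coord y v‖⁻¹ : ℂ) • he.coord y v) := by
    rw [map_smul, smul_smul, mul_inv_cancel₀ (by simpa using h0), one_smul, he.ofCoord_coord hy]
  have hunit := hsphere ((‖he.coord y v‖⁻¹ : ℂ) • he.coord y v)
    (by simpa using norm_smul_inv_norm (𝕜 := ℂ) h0)
  rw [mul_comm]
  conv_rhs => rw [hv, norm_form_smul_self, Complex.norm_real, norm_norm]
  gcongr

end IsFiberwiseLinear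

theorem isContinuousSection_of_uniform_approx (β : V.Metric) {s : ∀ x, V.Fiber x}
    (h : ∀ ε > 0, ∃ t : ∀ x, V.Fiber x, IsContinuousSection t ∧
      ∀ x, ‖β.form (s x - t x) (s x - t x)‖ ≤ ε) : IsContinuousSection s := by
  refine continuous_iff_continuousAt.2 fun x => ?_
  obtain ⟨n, e, hx, he : IsFiberwiseLinear e⟩ := V.locally_trivial x
  obtain ⟨δ, hδ, hbound⟩ := he.exists_pos_eventually_mul_norm_coord_sq_le β hx
  rw [he.continuousAt_section_iff_coord s hx]
  refine continuousAt_of_locally_uniform_approx_of_continuousAt fun U hU => ?_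
  obtain ⟨ε, hε, hεU⟩ := Metric.mem_uniformity_dist.1 hU
  obtain ⟨t, ht, hst⟩ := h (δ * (ε / 2) ^ 2) (by positivity)
  refine ⟨_, hbound, fun y => he.coord y (t y),
    (he.continuousAt_section_iff_coord t hx).1 ht.continuousAt, fun y hy => hεU ?_⟩
  have hsq : ‖he.coord y (s y - t y)‖ ^ 2 ≤ (ε / 2) ^ 2 :=
    le_of_mul_le_mul_left ((hy (s y - t y)).trans (hst y)) hδ
  rw [dist_eq_norm, ← map_sub]
  exact (le_of_sq_le_sq hsq (half_pos hε).le).trans_lt (half_lt_self hε)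

end UniformApproximation

section Complete

open HilbertC0

variable {β : V.Metric}

theorem finiteDimensional_fiber (V : ComplexVectorBundle.{u, w} X) (x : X) :
    FiniteDimensional ℂ (V.Fiber x) := by
  obtain ⟨n, e, hx, he : IsFiberwiseLinear e⟩ := V.locally_trivial x
  exact (he.coordEquiv hx).symm.finiteDimensional

instance completeSpace_fiber_sectionsC0 (x : X) :
    CompleteSpace (HilbertC0.Fiber (V.sectionsC0 β) x) :=
  have := V.finiteDimensional_fiber x
  have := FiniteDimensional.of_injective (ofFiber β x) (ofFiber_injective x)
  FiniteDimensional.complete ℂ _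

theorem norm_form_ofFiber (x : X) (v : HilbertC0.Fiber (V.sectionsC0 β) x) :
    ‖β.form (ofFiber β x v) (ofFiber β x v)‖ = ‖v‖ ^ 2 := by
  obtain ⟨s, rfl⟩ := evalAt_surjective x v
  rw [ofFiber_evalAt, norm_evalAt_sq, inner_apply]

theorem ofFiber_mem_sectionsC0 {v : ∀ x, HilbertC0.Fiber (V.sectionsC0 β) x}
    (hv : ∀ ε > 0, ∃ t : V.sectionsC0 β, ∀ x, ‖evalAt x t - v x‖ ≤ ε) :
    (fun x => ofFiber β x (v x)) ∈ V.sectionsC0 β := by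
  refine ⟨isContinuousSection_of_uniform_approx β fun ε hε => ?_,
    tendsto_zero_iff_norm_tendsto_zero.2 ?_⟩
  · obtain ⟨t, ht⟩ := hv (√ε) (Real.sqrt_pos.2 hε)
    refine ⟨t.1, t.2.1, fun x => ?_⟩
    rw [← ofFiber_evalAt x t, ← map_sub, norm_form_ofFiber, norm_sub_rev]
    exact (Real.le_sqrt (norm_nonneg _) hε.le).1 (ht x)
  · simpa only [norm_form_ofFiber, zero_pow two_ne_zero] using
      (tendsto_norm_cocompact_of_approx hv).pow 2

variable (β) in
theorem completeSpace_sectionsC0 : CompleteSpace (V.sectionsC0 β) := by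
  refine Metric.complete_of_cauchySeq_tendsto fun u hu => ?_
  obtain ⟨v, hv⟩ := exists_fiberwise_limit (X := X) hu
  have hmem : (fun x => ofFiber β x (v x)) ∈ V.sectionsC0 β :=
    ofFiber_mem_sectionsC0 fun ε hε => (hv ε hε).exists.imp' u fun _ h => h
  have hlim (x : X) : evalAt x (⟨_, hmem⟩ : V.sectionsC0 β) = v x :=
    ofFiber_injective x (ofFiber_evalAt x _)
  refine ⟨⟨_, hmem⟩, tendsto_iff_norm_sub_tendsto_zero.2 (Metric.tendsto_nhds.2 fun ε hε => ?_)⟩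
  filter_upwards [hv (ε / 2) (half_pos hε)] with n hn
  rw [dist_zero_right, norm_norm]
  refine (norm_le_of_forall_evalAt (X := X) (half_pos hε).le fun x => ?_).trans_lt
    (half_lt_self hε)
  rw [map_sub, hlim]
  exact hn x

end Complete

end ComplexVectorBundle

end

theorem mainTheorem7 {X : Type u} [TopologicalSpace X] [LocallyCompactSpace X] [T2Space X] :
    (∀ (V : ComplexVectorBundle.{u, w} X) (β : V.Metric),
      CompleteSpace (V.sectionsC0 β) ∧
      HilbertC0.IsSigmaFinitelyGenerated X (V.sectionsC0 β) ∧
      HilbertC0.IsSigmaProjective X (V.sectionsC0 β)) ∧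
    (∀ (E : Type v) [NormedAddCommGroup E] [NormedSpace ℂ E] [SMul C₀(X, ℂ) E]
      [CStarModule C₀(X, ℂ) E] [CompleteSpace E],
      HilbertC0.IsFull X E →
      HilbertC0.IsSigmaFinitelyGenerated X E →
      HilbertC0.IsSigmaProjective X E →
      ∃ (V : ComplexVectorBundle.{u, v} X) (β : V.Metric) (T : E ≃ₗ[ℂ] V.sectionsC0 β),
        (∀ (f : C₀(X, ℂ)) (ξ : E), T (f • ξ) = f • T ξ) ∧
        ∀ ξ η : E, inner C₀(X, ℂ) (T ξ) (T η) = inner C₀(X, ℂ) ξ η) := by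
  open ComplexVectorBundle in
  refine ⟨fun V β => ⟨completeSpace_sectionsC0 β, isSigmaFinitelyGenerated_sectionsC0 β,
    isSigmaProjective_sectionsC0 β⟩, ?_⟩
  intro E _ _ _ _ _ hfull hfg hproj
  exact HilbertC0.exists_bundle hfull hfg hproj
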